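/- Let $n_2,n_3,d\ge 0$ be integers, let $G$ be the group of bijections of $[2]^{n_2}[3]^{n_3}=\{0,1\}^{n_2}\times\{0,1,2\}^{n_3}$ preserving Hamming distance $d_H$, let $D=\{\mathbf 0\}$ consist of the all-zero word, and let $G_D=\{g\in G: g(D)=D\}$. Let $K=\mathbb R$ or $K=\mathbb C$. **Representative sets.** Let a finite group $H$ act linearly on $K^X$, with $X$ finite. A family of matrices $U_i=[u_{i,j}\mid j\in J_i]$ with columns in $K^X$ and $J_i\ne\emptyset$ is a *representative set* for the action if $K^X=\bigoplus_{i}\bigoplus_{j\in J_i}V_{i,j}$ with pairwise orthogonal irreducible submodules $V_{i,j}$, where $V_{i,j}\cong V_{i',j'}$ if and only if $i=i'$, such that $0\neq u_{i,j}\in V_{i,j}$ and for all $i,j,j'$ some $H$-isomorphism $V_{i,j}\to V_{i,j'}$ maps $u_{i,j}$ to $u_{i,j'}$. A group acting on $X$ acts on $K^X$ by $(g\cdot f)(x)=f(g^{-1}x)$. **Tableau vectors.** For a partition $\lambda$ of $n$ with Ferrers diagram $Y(\lambda)$, ordered by concatenating the rows, let $R_\lambda,C_\lambda\le S_{Y(\lambda)}$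 be the row and column stabilizers, and let $T_{\lambda,m}$ be the set of $\tau:Y(\lambda)\to[m]=\{1,\dots,m\}$ that are nondecreasing in rows and strictly increasing in columns. Write $\tau'\sim\tau$ if $\tau'=\tau\pi$ for some $\pi\in R_\lambda$. For a $q\times m$ matrix $B$ with columns $B(1),\dots,B(m)$ put $$u_{\tau,B}=\sum_{\tau'\sim\tau}\ \sum_{c\in C_\lambda}\operatorname{sgn}(c)\bigotimes_{y\in Y(\lambda)}B(\tau'c(y))\in (K^q)^{\otimes n}.$$ Let $e_1,e_2$ and $f_1,f_2,f_3$ be the unit vectors of $K^{2}$ and $K^{3}$ ($e_1,f_1$ corresponding to the letter $0$), and let $A_1=[e_1,e_2]$, $A_2=[f_1,f_2+f_3]$, $A_3=[f_2-f_3]$. For $\boldsymbol\lambda=(\lambda_1,\lambda_2,\lambda_3)$ with $\lambda_1\vdash n_2$, $\lambda_2\vdash l_2$, $\lambda_3\vdash l_3$, $l_2+l_3=n_3$, let $W_{\boldsymbol\lambda}=T_{\lambda_1,2}\times T_{\lambda_2,2}\times T_{\lambda_3,1}$, and for $\boldsymbol\tau\in W_{\boldsymbol\lambda}$ let $u_{\boldsymbol\tau}=u_{\tau_1,A_1}\otimes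 u_{\tau_2,A_2}\otimes u_{\tau_3,A_3}\in (K^2)^{\otimes n_2}\otimes(K^3)^{\otimes n_3}=K^{[2]^{n_2}[3]^{n_3}}$. Let $$W'_{\boldsymbol\lambda}=\{\boldsymbol\tau\in W_{\boldsymbol\lambda}: n_2+n_3-|\tau_1^{-1}(1)|-|\tau_2^{-1}(1)|\in\{0,d,d+1,\dots,n_2+n_3\}\}.$$ **Codes.** Let $S_d(D)$ be the set of codes $C\subseteq[2]^{n_2}[3]^{n_3}$ with $|C|\le 3$, $D\subseteq C$, $|D|+2|C\setminus D|\le 3$ and $d_H(v,w)\ge d$ for all distinct $v,w\in C$. These are the codes $\{\mathbf 0,v\}$ with $v$ of weight $0$ or at least $d$, and $u\in K^{[2]^{n_2}[3]^{n_3}}$ is regarded as an element of $K^{S_d(D)}$ with coordinate $u(v)$ at $\{\mathbf 0,v\}$. **Proposition.** 1. $G_D= S_{n_2}\times(S_2^{n_3}\rtimes S_{n_3})$, where $S_{n_2}$ permutes the binary coordinates, $S_{n_3}$ permutes the ternary coordinates, and $S_2^{n_3}$ permutes the two nonzero letters in each ternary coordinate. 2. The matrices $[u_{\boldsymbol\tau}\mid\boldsymbol\tau\in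 W_{\boldsymbol\lambda}]$, for all $\boldsymbol\lambda$ as above with $W_{\boldsymbol\lambda}\neq\emptyset$, form a representative set for the action of $G_D$ on $K^{[2]^{n_2}[3]^{n_3}}$. 3. The matrices $[u_{\boldsymbol\tau}\mid\boldsymbol\tau\in W'_{\boldsymbol\lambda}]$, for all $\boldsymbol\lambda$ as above with $W'_{\boldsymbol\lambda}\neq\emptyset$, form a representative set for the action of $G_D$ on $K^{S_d(D)}$. -/

import Mathlib

open scoped Pointwise

/-! ### Representative sets -/

section Representative

variable {𝕜 : Type*} [RCLike 𝕜] {G : Type*} [Group G]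

/-- The action of `G` on functions `X → 𝕜` induced by an action of `G` on `X`:
`(g • f) x = f (g⁻¹ • x)`. -/
def permRep (𝕜 : Type*) [RCLike 𝕜] (G : Type*) [Group G] (X : Type*) [MulAction G X] :
    Representation 𝕜 G (X → 𝕜) where
  toFun g :=
    { toFun := fun f x => f (g⁻¹ • x)
      map_add' := fun _ _ => rfl
      map_smul' := fun _ _ => rfl }
  map_one' := by
    ext f x
    simp
  map_mul' g h := by
    ext f x
    simp [mul_smul]

/-- `IsRepresentativeSet ρ U`: the matrices `U i`, with columns indexed by the nonempty types
`J i`, form a representative set for the representation `ρ` of `G` on `𝕜 ^ X`. That is, `𝕜 ^ X`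
is the direct sum of pairwise orthogonal irreducible subrepresentations `V i j`, where `V i j`
and `V i' j'` are isomorphic exactly when `i = i'`; the `j`-th column of `U i` is a nonzero vector
of `V i j`; and for each `i` and all `j, j'` some isomorphism `V i j ≃ V i j'` of representations
maps the `j`-th column of `U i` to the `j'`-th one. -/
def IsRepresentativeSet {X : Type*} [Fintype X] (ρ : Representation 𝕜 G (X → 𝕜))
    {ι : Type*} {J : ι → Type*} (U : ∀ i, Matrix X (J i) 𝕜) : Prop :=
  (∀ i, Nonempty (J i)) ∧
  ∃ V : ∀ i, J i → Subrepresentation ρ,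
    (∀ i j, (V i j).toRepresentation.IsIrreducible) ∧
    iSupIndep (fun p : Σ i, J i => (V p.1 p.2).toSubmodule) ∧
    (⨆ p : Σ i, J i, (V p.1 p.2).toSubmodule) = ⊤ ∧
    (∀ p q : Σ i, J i, p ≠ q → ∀ v ∈ V p.1 p.2, ∀ w ∈ V q.1 q.2, star v ⬝ᵥ w = 0) ∧
    (∀ i i' j j', Nonempty ((V i j).toRepresentation.Equiv (V i' j').toRepresentation) ↔ i = i') ∧
    ∃ hmem : ∀ i j, (U i).col j ∈ (V i j).toSubmodule,
      (∀ i j, (U i).col j ≠ 0) ∧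
      ∀ i j j', ∃ φ : (V i j).toRepresentation.Equiv (V i j').toRepresentation,
        φ ⟨(U i).col j, hmem i j⟩ = ⟨(U i).col j', hmem i j'⟩

end Representative

/-! ### Words, codes and isometries -/

section Codes

/-- The words of `[2]^{n₂}[3]^{n₃}`; the letters are `0, 1` and `0, 1, 2`, and `(0, 0)` is the
all-zero word. -/
abbrev Word (n₂ n₃ : ℕ) : Type := (Fin n₂ → Fin 2) × (Fin n₃ → Fin 3)

/-- The Hamming distance. -/
def wordDist {n₂ n₃ : ℕ} (v w : Word n₂ n₃) : ℕ := hammingDist v.1 w.1 + hammingDist v.2 w.2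

/-- The group of Hamming distance-preserving bijections of `[2]^{n₂}[3]^{n₃}`. -/
def isometryGroup (n₂ n₃ : ℕ) : Subgroup (Equiv.Perm (Word n₂ n₃)) where
  carrier := {g | ∀ v w, wordDist (g v) (g w) = wordDist v w}
  mul_mem' {a b} ha hb v w := by
    rw [Equiv.Perm.mul_apply, Equiv.Perm.mul_apply, ha, hb]
  one_mem' _ _ := rfl
  inv_mem' {a} ha v w := by
    rw [← ha]
    simp

/-- The subgroup `G_D` of the isometries that leave the code `D` invariant. -/
abbrev codeStabilizer {n₂ n₃ : ℕ} (D : Finset (Word n₂ n₃)) : Subgroup (isometryGroup n₂ n₃) :=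
  MulAction.stabilizer (isometryGroup n₂ n₃) D

/-- `S(D)`: the codes `C` with `|C| ≤ k`, `D ⊆ C` and `|D| + 2 |C \ D| ≤ k`. -/
def codesOver {n₂ n₃ : ℕ} (k : ℕ) (D : Finset (Word n₂ n₃)) : Set (Finset (Word n₂ n₃)) :=
  {C | C.card ≤ k ∧ D ⊆ C ∧ D.card + 2 * (C \ D).card ≤ k}

/-- The codes in `S(D)` whose minimum distance is not less than `d`, with their action of `G_D`. -/
def admissibleCodes {n₂ n₃ : ℕ} (k d : ℕ) (D : Finset (Word n₂ n₃)) :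
    SubMulAction (codeStabilizer D) (Finset (Word n₂ n₃)) where
  carrier := {C | C ∈ codesOver k D ∧ ∀ v ∈ C, ∀ w ∈ C, v ≠ w → d ≤ wordDist v w}
  smul_mem' g C hC := by
    obtain ⟨⟨h1, h2, h3⟩, h4⟩ := hC
    have hD : g • D = D := g.2
    refine ⟨⟨?_, ?_, ?_⟩, ?_⟩
    · rwa [Finset.card_smul_finset]
    · refine hD.symm.subset.trans ?_
      exact Finset.smul_finset_subset_smul_finset h2
    · have h : g • C \ D = g • (C \ D) := by
        rw [Finset.smul_finset_sdiff, hD]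
      rwa [h, Finset.card_smul_finset]
    · intro v hv w hw hne
      obtain ⟨v', hv', rfl⟩ := Finset.mem_smul_finset.1 hv
      obtain ⟨w', hw', rfl⟩ := Finset.mem_smul_finset.1 hw
      have hd : wordDist (g • v') (g • w') = wordDist v' w' := g.1.2 v' w'
      rw [hd]
      exact h4 v' hv' w' hw' fun e => hne (by rw [e])

noncomputable instance {n₂ n₃ : ℕ} (k d : ℕ) (D : Finset (Word n₂ n₃)) :
    Fintype (admissibleCodes k d D) := Fintype.ofFinite _

end Codes

/-! ### Tableaux -/

section Tableaux

/-- The cells `(i, j)` (row `i`, column `j`) of a Young diagram, numbered in the order obtained by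
concatenating the rows, starting from the first row. -/
noncomputable def rowReading (μ : YoungDiagram) : μ.cells ≃ Fin μ.card :=
  (μ.cells.equivMap toLex.toEmbedding).trans
    ((μ.cells.map toLex.toEmbedding).orderIsoOfFin (Finset.card_map _)).symm.toEquiv

/-- The row stabilizer. -/
def rowStabilizer (μ : YoungDiagram) : Subgroup (Equiv.Perm μ.cells) where
  carrier := {π | ∀ y, (π y).1.1 = y.1.1}
  mul_mem' {a b} ha hb y := by rw [Equiv.Perm.mul_apply, ha, hb]
  one_mem' _ := rfl
  inv_mem' {a} ha y := by
    rw [← ha]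
    simp

/-- The column stabilizer. -/
def colStabilizer (μ : YoungDiagram) : Subgroup (Equiv.Perm μ.cells) where
  carrier := {π | ∀ y, (π y).1.2 = y.1.2}
  mul_mem' {a b} ha hb y := by rw [Equiv.Perm.mul_apply, ha, hb]
  one_mem' _ := rfl
  inv_mem' {a} ha y := by
    rw [← ha]
    simp

/-- Row equivalence of Young tableaux with entries in `Fin m`. -/
def RowEquiv {μ : YoungDiagram} {m : ℕ} (τ τ' : μ.cells → Fin m) : Prop :=
  ∃ π ∈ rowStabilizer μ, τ' = τ ∘ π

/-- Semistandard: nondecreasing in each row, increasing in each column. -/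
def IsSemistandard {μ : YoungDiagram} {m : ℕ} (τ : μ.cells → Fin m) : Prop :=
  (∀ y z : μ.cells, y.1.1 = z.1.1 → y.1.2 ≤ z.1.2 → τ y ≤ τ z) ∧
  (∀ y z : μ.cells, y.1.2 = z.1.2 → y.1.1 < z.1.1 → τ y < τ z)

/-- `T_{μ,m}`: the semistandard Young tableaux of shape `μ` with entries in `Fin m`. -/
abbrev SSTableau (μ : YoungDiagram) (m : ℕ) : Type := {τ : μ.cells → Fin m // IsSemistandard τ}

open Classical in
/-- The vector `u_{τ,B} = ∑_{τ' ∼ τ} ∑_{c ∈ C_μ} sgn(c) ⨂_{y} B(τ' c(y))`, where `B(l)` is the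
`l`-th column of `B`. The tensor power of `𝕜 ^ [q]` is identified with the functions on the words
`x ∈ [q]^n`, so that a pure tensor has the product of the coordinates as its value at `x`. -/
noncomputable def tableauVec {𝕜 : Type*} [RCLike 𝕜] {q m : ℕ} (B : Matrix (Fin q) (Fin m) 𝕜)
    {μ : YoungDiagram} (τ : μ.cells → Fin m) (x : Fin μ.card → Fin q) : 𝕜 :=
  ∑ τ' : μ.cells → Fin m with RowEquiv τ τ',
    ∑ c : Equiv.Perm μ.cells with c ∈ colStabilizer μ,
      ((Equiv.Perm.sign c : ℤ) : 𝕜) * ∏ y : μ.cells, B (x (rowReading μ y)) (τ' (c y))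

end Tableaux

/-! ### The representative set of a code of size one -/

section SizeOne

/-- `A₁ = [e₁, e₂]`. -/
def matA₁ (𝕜 : Type*) [RCLike 𝕜] : Matrix (Fin 2) (Fin 2) 𝕜 := !![1, 0; 0, 1]

/-- `A₂ = [f₁, f₂ + f₃]`. -/
def matA₂ (𝕜 : Type*) [RCLike 𝕜] : Matrix (Fin 3) (Fin 2) 𝕜 := !![1, 0; 0, 1; 0, 1]

/-- `A₃ = [f₂ - f₃]`. -/
def matA₃ (𝕜 : Type*) [RCLike 𝕜] : Matrix (Fin 3) (Fin 1) 𝕜 := !![0; 1; -1]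

/-- The triples of partitions `(μ₁, μ₂, μ₃) ⊢ (n₂, l₂, l₃)` with `l₂ + l₃ = n₃`; here
`l₂ = |μ₂|` and `l₃ = |μ₃|`. -/
structure ShapeTriple (n₂ n₃ : ℕ) where
  μ₁ : YoungDiagram
  μ₂ : YoungDiagram
  μ₃ : YoungDiagram
  card₁ : μ₁.card = n₂
  card₂₃ : μ₂.card + μ₃.card = n₃

variable {n₂ n₃ : ℕ}

/-- `W_λ = T_{λ₁,2} × T_{λ₂,2} × T_{λ₃,1}`. -/
abbrev ShapeTriple.W (s : ShapeTriple n₂ n₃) : Type :=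
  SSTableau s.μ₁ 2 × SSTableau s.μ₂ 2 × SSTableau s.μ₃ 1

/-- The weight `n₂ + n₃ - |τ₁⁻¹(1)| - |τ₂⁻¹(1)|` (as an integer), where the first letter is called
`0` in `Fin 2`. -/
def ShapeTriple.weight (s : ShapeTriple n₂ n₃) (τ : s.W) : ℤ :=
  n₂ + n₃ - (Finset.univ.filter fun y => τ.1.1 y = 0).card
    - (Finset.univ.filter fun y => τ.2.1.1 y = 0).card

/-- `W'_λ`: the triples of tableaux of weight `0` or at least `d`. -/
abbrev ShapeTriple.W' (s : ShapeTriple n₂ n₃) (d : ℕ) : Type :=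
  {τ : s.W // s.weight τ = 0 ∨ (d : ℤ) ≤ s.weight τ}

/-- `u_τ = u_{τ₁,A₁} ⊗ u_{τ₂,A₂} ⊗ u_{τ₃,A₃}` as a function on words: `u_{τ₁,A₁}` is evaluated at
the binary part, `u_{τ₂,A₂}` at the first `l₂` and `u_{τ₃,A₃}` at the last `l₃` ternary letters. -/
noncomputable def ShapeTriple.vec (𝕜 : Type*) [RCLike 𝕜] (s : ShapeTriple n₂ n₃) (τ : s.W)
    (v : Word n₂ n₃) : 𝕜 :=
  tableauVec (matA₁ 𝕜) τ.1.1 (fun i => v.1 (Fin.cast s.card₁ i)) *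
  tableauVec (matA₂ 𝕜) τ.2.1.1 (fun i => v.2 (Fin.cast s.card₂₃ (Fin.castAdd _ i))) *
  tableauVec (matA₃ 𝕜) τ.2.2.1 (fun i => v.2 (Fin.cast s.card₂₃ (Fin.natAdd _ i)))

/-- The matrix `[u_τ | τ ∈ W_λ]`. -/
noncomputable def wordMatrix (𝕜 : Type*) [RCLike 𝕜] (s : ShapeTriple n₂ n₃) :
    Matrix (Word n₂ n₃) s.W 𝕜 :=
  Matrix.of fun v τ => s.vec 𝕜 τ v

/-- The matrix `[u_τ | τ ∈ W'_λ]`, its rows indexed by the codes `C = {0, v}` of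
`S({0})` (with `k = 3`) of minimum distance not less than `d`. The entry in row `C` is `u_τ(v)`: the
sum has exactly one term, as `C` determines `v` (and `v = 0` for `C = {0}`). -/
noncomputable def codeMatrix (𝕜 : Type*) [RCLike 𝕜] (d : ℕ) (s : ShapeTriple n₂ n₃) :
    Matrix (admissibleCodes 3 d {(0 : Word n₂ n₃)}) (s.W' d) 𝕜 :=
  Matrix.of fun C τ => ∑ v : Word n₂ n₃ with ({0, v} : Finset (Word n₂ n₃)) = C.1, s.vec 𝕜 τ.1 v

/-- A permutation of the two nonzero letters of `[3]`, as a map on letters fixing `0`. -/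
def letterMap (s : Equiv.Perm (Fin 2)) : Fin 3 → Fin 3 := Fin.cases 0 fun i => (s i).succ

end SizeOne

/-!
The stabilizer of the zero word is found by letting it act on the words of weight one: these
correspond to the nonzero letters, and two letters at the same ternary coordinate are
recognized by the fact that no word contains both (`coordHom_surjective`).

For the representative sets no theory of Specht modules is needed. Suppose that vectors `u i j` are
nonzero, have pairwise orthogonal `G`-orbits, and that for fixed `i` equivariant endomorphisms of
`𝕜 ^ X` carry them to nonzero multiples of each other. Then the functionals
`T ↦ ⟪u i j', T (u i j)⟫` on `End_G (𝕜 ^ X)` are linearly independent. The dimension of this space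
is at most the number of orbits of `G` on `X × X`, so if there are no more orbits than triples
`(i, j, j')`, an equivariant endomorphism killed by all these functionals vanishes. Applied to
orthogonal projections and to isomorphisms between the modules generated by the `u i j`, this gives
irreducibility, non-isomorphism and exhaustion (`isRepresentativeSet_of_separates_orbits`).

The hypotheses are verified from an explicit formula (`ShapeTriple.vec_eq`). With two letters, the
row and column sums collapse and `u_τ` is the restriction to the words of a given binary and a given
ternary weight of a product that depends on the shapes only: one factor `[x_b ≠ 0] - [x_a ≠ 0]` for
each column `(a, b)` of length two, and one factor `±1` or `0` for each of the last `l₃` ternary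
letters (`PairData.poly`).

* Orthogonality: functions supported on words of different weights are orthogonal; if the sets of
  the last `l₃` coordinates are moved to different sets, a flip of one letter changes one sign only;
  and if one product has fewer pairs than the other, each of its monomials misses both members of a
  pair of the other one, whose exchange changes one sign only
  (`PairData.sum_slice_mul_slice_of_lt`).
* Change of content: the operators `raise` and `lower`, which replace one letter by zero or one zero
  by a letter, are equivariant and multiply the product by an explicit constant, since the
  contributions of the two members of a pair cancel (`mapsToMultiple_sliceProd`).
* Orbits of pairs: at each coordinate a pair of words has one of the types `(0, 0)`, `(0, *)`,
  `(*, 0)`, equal or distinct nonzero letters. The orbit of the pair is determined by the weights of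
  the two words, the number `l₃` of coordinates of the last type, and the minima `k` of the numbers
  of coordinates of the first and the fourth type. These numbers are exactly the parameters
  of a triple of shapes with two tableau triples (`exists_smul_pair_eq`,
  `ShapeTriple.exists_tableaux`).
-/

/-! ### A criterion for representative sets -/

section Criterion

variable {𝕜 : Type*} [RCLike 𝕜] {G : Type*} [Group G] {X : Type*} [MulAction G X]

lemma permRep_apply (g : G) (f : X → 𝕜) (x : X) : permRep 𝕜 G X g f x = f (g⁻¹ • x) := rfl

/-- The subrepresentation generated by a vector. -/
def cyclicSubrep (f : X → 𝕜) : Subrepresentation (permRep 𝕜 G X) where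
  toSubmodule := Submodule.span 𝕜 (Set.range fun g : G => permRep 𝕜 G X g f)
  apply_mem_toSubmodule g v hv := by
    induction hv using Submodule.span_induction with
    | mem x hx =>
      obtain ⟨h, rfl⟩ := hx
      exact Submodule.subset_span ⟨g * h, by simp⟩
    | zero => simp
    | add x y _ _ hx hy => rw [map_add]; exact add_mem hx hy
    | smul c x _ hx => rw [map_smul]; exact Submodule.smul_mem _ _ hx

lemma mem_cyclicSubrep (f : X → 𝕜) : f ∈ (cyclicSubrep (G := G) f).toSubmodule :=
  Submodule.subset_span ⟨1, by simp⟩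

/-- Two equivariant maps agreeing on the generator agree on the generated subrepresentation. -/
lemma eq_of_mem_cyclicSubrep {f : X → 𝕜} {S T : (X → 𝕜) →ₗ[𝕜] (X → 𝕜)}
    (hS : ∀ (g : G) f, S (permRep 𝕜 G X g f) = permRep 𝕜 G X g (S f))
    (hT : ∀ (g : G) f, T (permRep 𝕜 G X g f) = permRep 𝕜 G X g (T f))
    (h : S f = T f) {v : X → 𝕜} (hv : v ∈ (cyclicSubrep (G := G) f).toSubmodule) : S v = T v := by
  refine LinearMap.eqOn_span' (s := Set.range fun g : G => permRep 𝕜 G X g f) ?_ hv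
  rintro _ ⟨g, rfl⟩
  simp only [hS, hT, h]

variable (𝕜 G X) in
/-- The equivariant endomorphisms of a permutation representation. -/
def equivariantEnd : Submodule 𝕜 (Module.End 𝕜 (X → 𝕜)) where
  carrier := {T | ∀ (g : G) f, T (permRep 𝕜 G X g f) = permRep 𝕜 G X g (T f)}
  add_mem' ha hb g f := by simp only [LinearMap.add_apply, ha g f, hb g f, map_add]
  zero_mem' _ _ := by simp
  smul_mem' c _ h g f := by simp only [LinearMap.smul_apply, h g f, map_smul]

/-- If equivariant maps take two vectors to nonzero multiples of each other, then the generated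
subrepresentations are isomorphic. -/
lemma exists_equiv_cyclicSubrep {u v : X → 𝕜}
    (huv : ∃ Φ ∈ equivariantEnd 𝕜 G X, ∃ c : 𝕜, c ≠ 0 ∧ Φ u = c • v)
    (hvu : ∃ Φ ∈ equivariantEnd 𝕜 G X, ∃ c : 𝕜, c ≠ 0 ∧ Φ v = c • u) :
    ∃ φ : (cyclicSubrep (G := G) u).toRepresentation.Equiv
        (cyclicSubrep (G := G) v).toRepresentation,
      φ ⟨u, mem_cyclicSubrep u⟩ = ⟨v, mem_cyclicSubrep v⟩ := by
  have norm : ∀ {u v : X → 𝕜},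
      (∃ Φ ∈ equivariantEnd 𝕜 G X, ∃ c : 𝕜, c ≠ 0 ∧ Φ u = c • v) →
      ∃ Φ ∈ equivariantEnd 𝕜 G X, Φ u = v ∧ ∀ w ∈ (cyclicSubrep (G := G) u).toSubmodule,
        Φ w ∈ (cyclicSubrep (G := G) v).toSubmodule := by
    rintro u v ⟨Φ, hΦ, c, hc, h⟩
    have h1 : (c⁻¹ • Φ) u = v := by rw [LinearMap.smul_apply, h, inv_smul_smul₀ hc]
    refine ⟨c⁻¹ • Φ, Submodule.smul_mem _ _ hΦ, h1, fun w hw => ?_⟩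
    induction hw using Submodule.span_induction with
    | mem x hx =>
      obtain ⟨g, rfl⟩ := hx
      refine Submodule.subset_span ⟨g, ?_⟩
      simp only
      rw [(equivariantEnd 𝕜 G X).smul_mem c⁻¹ hΦ g, h1]
    | zero => simp
    | add x y _ _ hx hy => rw [map_add]; exact add_mem hx hy
    | smul c x _ hx => rw [map_smul]; exact Submodule.smul_mem _ _ hx
  obtain ⟨Φ, hΦ, hΦu, hΦm⟩ := norm huv
  obtain ⟨Ψ, hΨ, hΨv, hΨm⟩ := norm hvu
  have h1 : ∀ w ∈ (cyclicSubrep (G := G) u).toSubmodule, (Ψ ∘ₗ Φ) w = LinearMap.id (R := 𝕜) w :=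
    fun w => eq_of_mem_cyclicSubrep
      (fun g f => by simp only [LinearMap.comp_apply, hΦ g, hΨ g]) (fun g f => rfl)
      (by simp [hΦu, hΨv])
  have h2 : ∀ w ∈ (cyclicSubrep (G := G) v).toSubmodule, (Φ ∘ₗ Ψ) w = LinearMap.id (R := 𝕜) w :=
    fun w => eq_of_mem_cyclicSubrep
      (fun g f => by simp only [LinearMap.comp_apply, hΦ g, hΨ g]) (fun g f => rfl)
      (by simp [hΦu, hΨv])
  refine ⟨Representation.Equiv.mk (LinearEquiv.ofLinearMap (Φ.restrict hΦm) (Ψ.restrict hΨm)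
    (LinearMap.ext fun w => Subtype.ext (h2 w.1 w.2))
    (LinearMap.ext fun w => Subtype.ext (h1 w.1 w.2)))
    (fun g => LinearMap.ext fun w => Subtype.ext (hΦ g w.1)), Subtype.ext hΦu⟩

variable [Fintype X]

lemma star_permRep_dotProduct (g : G) (f h : X → 𝕜) :
    star (permRep 𝕜 G X g f) ⬝ᵥ permRep 𝕜 G X g h = star f ⬝ᵥ h :=
  Equiv.sum_comp (MulAction.toPerm g⁻¹ : Equiv.Perm X) fun x => star (f x) * h x

lemma star_dotProduct_permRep (g : G) (f h : X → 𝕜) :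
    star f ⬝ᵥ permRep 𝕜 G X g h = star (permRep 𝕜 G X g⁻¹ f) ⬝ᵥ h := by
  rw [← star_permRep_dotProduct g (permRep 𝕜 G X g⁻¹ f), ← Module.End.mul_apply, ← map_mul,
    mul_inv_cancel, map_one, Module.End.one_apply]

open scoped ComplexOrder in
lemma star_dotProduct_self_eq_zero {f : X → 𝕜} : star f ⬝ᵥ f = 0 ↔ f = 0 :=
  dotProduct_star_self_eq_zero

/-- The orthogonal projection onto a subrepresentation of a permutation representation is
equivariant. -/
lemma exists_equivariant_projection (S : Subrepresentation (permRep 𝕜 G X)) :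
    ∃ P : (X → 𝕜) →ₗ[𝕜] (X → 𝕜),
      (∀ g f, P (permRep 𝕜 G X g f) = permRep 𝕜 G X g (P f)) ∧ (∀ f, P f ∈ S.toSubmodule) ∧
      (∀ f ∈ S.toSubmodule, P f = f) ∧
      (∀ f, (∀ s ∈ S.toSubmodule, star s ⬝ᵥ f = 0) → P f = 0) ∧
      ∀ f, ∀ s ∈ S.toSubmodule, star s ⬝ᵥ (f - P f) = 0 := by
  let e := WithLp.linearEquiv 2 𝕜 (X → 𝕜)
  let K : Submodule 𝕜 (EuclideanSpace 𝕜 X) := S.toSubmodule.comap e.toLinearMap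
  let P : (X → 𝕜) →ₗ[𝕜] (X → 𝕜) :=
    e.toLinearMap ∘ₗ K.starProjection.toLinearMap ∘ₗ e.symm.toLinearMap
  have hmem : ∀ f, P f ∈ S.toSubmodule := fun f =>
    (Submodule.starProjection_apply_mem K (e.symm f) : K.starProjection (e.symm f) ∈ K)
  have hid : ∀ f ∈ S.toSubmodule, P f = f := by
    intro f hf
    have h : e.symm f ∈ K := by simpa [K] using hf
    simp [P, Submodule.starProjection_eq_self_iff.2 h]
  have hker : ∀ f, (∀ s ∈ S.toSubmodule, star s ⬝ᵥ f = 0) → P f = 0 := by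
    intro f hf
    have h : e.symm f ∈ Kᗮ := by
      rw [Submodule.mem_orthogonal]
      intro u hu
      rw [EuclideanSpace.inner_eq_star_dotProduct, dotProduct_comm]
      exact hf _ hu
    simp [P, (Submodule.starProjection_apply_eq_zero_iff K).2 h]
  have hsub : ∀ f, ∀ s ∈ S.toSubmodule, star s ⬝ᵥ (f - P f) = 0 := by
    intro f s hs
    have h := Submodule.sub_starProjection_mem_orthogonal (K := K) (e.symm f)
    rw [Submodule.mem_orthogonal] at h
    have h' := h (e.symm s) (by simpa [K] using hs)
    rw [EuclideanSpace.inner_eq_star_dotProduct, dotProduct_comm] at h'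
    exact h'
  refine ⟨P, fun g f => ?_, hmem, hid, hker, hsub⟩
  have h1 : P (permRep 𝕜 G X g (f - P f)) = 0 := hker _ fun s hs => by
    rw [star_dotProduct_permRep]
    exact hsub f _ (S.apply_mem_toSubmodule _ hs)
  have h2 := hid _ (S.apply_mem_toSubmodule g (hmem f))
  rw [map_sub, map_sub, h2, sub_eq_zero] at h1
  exact h1

lemma star_dotProduct_of_mem_cyclicSubrep {f h : X → 𝕜}
    (H : ∀ g : G, star (permRep 𝕜 G X g f) ⬝ᵥ h = 0) {v w : X → 𝕜}
    (hv : v ∈ (cyclicSubrep (G := G) f).toSubmodule)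
    (hw : w ∈ (cyclicSubrep (G := G) h).toSubmodule) : star v ⬝ᵥ w = 0 := by
  induction hw using Submodule.span_induction with
  | mem x hx =>
    obtain ⟨g, rfl⟩ := hx
    induction hv using Submodule.span_induction with
    | mem x hx =>
      obtain ⟨g', rfl⟩ := hx
      simp only
      rw [star_dotProduct_permRep, ← Module.End.mul_apply, ← map_mul]
      exact H _
    | zero => simp
    | add x y _ _ hx hy => rw [star_add, add_dotProduct, hx, hy, add_zero]
    | smul c x _ hx => rw [star_smul, smul_dotProduct, hx, smul_zero]
  | zero => simp
  | add x y _ _ hx hy => rw [dotProduct_add, hx, hy, add_zero]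
  | smul c x _ hx => rw [dotProduct_smul, hx, smul_zero]

/-- The dimension of the space of equivariant endomorphisms is at most the number of orbits of
pairs. -/
lemma finrank_equivariantEnd_le {I : Type*} [Fintype I] (κ : X × X → I)
    (hκ : ∀ p q, κ p = κ q → ∃ g : G, g • p = q) :
    Module.finrank 𝕜 (equivariantEnd 𝕜 G X) ≤ Fintype.card I := by
  classical
  let rep : Set.range κ → X × X := fun z => z.2.choose
  have hrep : ∀ z, κ (rep z) = z.1 := fun z => z.2.choose_spec
  let F : equivariantEnd 𝕜 G X →ₗ[𝕜] (Set.range κ → 𝕜) :=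
    { toFun := fun T z => T.1 (Pi.single (rep z).2 1) (rep z).1
      map_add' := fun _ _ => rfl
      map_smul' := fun _ _ => rfl }
  have hF : Function.Injective F := by
    rw [injective_iff_map_eq_zero]
    intro T hT
    refine Subtype.ext (LinearMap.pi_ext' fun y => LinearMap.ext_ring ?_)
    ext x
    have hz : T.1 (Pi.single (rep ⟨κ (x, y), _, rfl⟩).2 1) (rep ⟨κ (x, y), _, rfl⟩).1 = 0 :=
      congrFun hT ⟨κ (x, y), _, rfl⟩
    obtain ⟨g, hg⟩ := hκ _ _ (hrep ⟨κ (x, y), _, rfl⟩)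
    generalize rep ⟨κ (x, y), _, rfl⟩ = p at hz hg
    obtain ⟨x', y'⟩ := p
    obtain ⟨rfl, rfl⟩ := Prod.ext_iff.1 hg
    have hs : (Pi.single (g • y') 1 : X → 𝕜) = permRep 𝕜 G X g (Pi.single y' 1) := by
      ext z
      simp only [permRep_apply, Pi.single_apply, inv_smul_eq_iff]
    change T.1 (Pi.single (g • y') 1) (g • x') = 0
    rw [hs, T.2 g, permRep_apply, inv_smul_smul]
    exact hz
  have h1 := LinearMap.finrank_le_finrank_of_injective hF
  rw [Module.finrank_fintype_fun_eq_card] at h1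
  exact h1.trans (Fintype.card_subtype_le _)

/-- **Criterion for representative sets.** Let `u i j` be nonzero vectors of `𝕜 ^ X` whose orbits
are pairwise orthogonal, such that equivariant maps take `u i j` to a nonzero multiple of
`u i j'`. If the orbits of pairs can be separated by a map into the type of all triples
`(i, j, j')`, then the `u i j` form a representative set.

The functionals `T ↦ ⟪u i j', T (u i j)⟫` on the equivariant endomorphisms are linearly independent,
and the number of orbits of pairs bounds the dimension. Hence an equivariant endomorphism
on which all these functionals vanish is zero, and this gives irreducibility, non-isomorphism and
exhaustion at once. -/
theorem isRepresentativeSet_of_separates_orbits {ι : Type*} {J : ι → Type*}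
    (U : ∀ i, Matrix X (J i) 𝕜) (hJ : ∀ i, Nonempty (J i)) (h0 : ∀ i j, (U i).col j ≠ 0)
    (horth : ∀ p q : Σ i, J i, p ≠ q → ∀ g : G,
      star (permRep 𝕜 G X g ((U p.1).col p.2)) ⬝ᵥ (U q.1).col q.2 = 0)
    (hΦ : ∀ i j j', ∃ Φ ∈ equivariantEnd 𝕜 G X, ∃ c : 𝕜, c ≠ 0 ∧
      Φ ((U i).col j) = c • (U i).col j')
    (κ : X × X → Σ i, J i × J i) (hκ : ∀ p q, κ p = κ q → ∃ g : G, g • p = q) :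
    IsRepresentativeSet (permRep 𝕜 G X) U := by
  classical
  let u : (Σ i, J i) → X → 𝕜 := fun p => (U p.1).col p.2
  let V : (Σ i, J i) → Subrepresentation (permRep 𝕜 G X) := fun p => cyclicSubrep (u p)
  have hu : ∀ p, u p ∈ (V p).toSubmodule := fun p => mem_cyclicSubrep _
  have hVorth : ∀ p q, p ≠ q → ∀ v ∈ (V p).toSubmodule, ∀ w ∈ (V q).toSubmodule,
      star v ⬝ᵥ w = 0 := fun p q hpq v hv w hw =>
    star_dotProduct_of_mem_cyclicSubrep (horth p q hpq) hv hw
  choose P hPeq hPmem hPid hPker hPsub using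
    fun p => exists_equivariant_projection (V p)
  have hPV : ∀ p q, p ≠ q → ∀ v ∈ (V q).toSubmodule, P p v = 0 := fun p q hpq v hv =>
    hPker p v fun s hs => hVorth p q hpq s hs v hv
  -- The generators are linearly independent, so there are finitely many of them.
  have hli : LinearIndependent 𝕜 u := by
    rw [linearIndependent_iff']
    intro s c hc p hp
    have h1 := congrArg (fun v => star (u p) ⬝ᵥ v) hc
    simp only [dotProduct_sum, dotProduct_smul, dotProduct_zero] at h1
    rw [Finset.sum_eq_single p (fun q _ hq => by
      rw [hVorth p q hq.symm _ (hu p) _ (hu q), smul_zero]) (fun h => absurd hp h)] at h1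
    exact (smul_eq_zero.1 h1).resolve_right fun h => h0 _ _ (star_dotProduct_self_eq_zero.1 h)
  have hfin1 : Finite (Σ i, J i) := hli.finite
  have hfin : Finite (Σ i, J i × J i) := by
    refine Finite.of_injective (β := (Σ i, J i) × (Σ i, J i))
      (fun z => (⟨z.1, z.2.1⟩, ⟨z.1, z.2.2⟩)) ?_
    rintro ⟨i, j, k⟩ ⟨i', j', k'⟩ h
    simp only [Prod.mk.injEq, Sigma.mk.injEq] at h
    obtain ⟨⟨rfl, h1⟩, -, h2⟩ := h
    rw [eq_of_heq h1, eq_of_heq h2]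
  have := Fintype.ofFinite (Σ i, J i × J i)
  let F : equivariantEnd 𝕜 G X →ₗ[𝕜] ((Σ i, J i × J i) → 𝕜) :=
    { toFun := fun T z => star (u ⟨z.1, z.2.2⟩) ⬝ᵥ T.1 (u ⟨z.1, z.2.1⟩)
      map_add' := fun S T => by
        ext z
        exact dotProduct_add _ _ _
      map_smul' := fun c T => by
        ext z
        exact dotProduct_smul c (star (u ⟨z.1, z.2.2⟩)) (T.1 (u ⟨z.1, z.2.1⟩)) }
  have hFsurj : Function.Surjective F := by
    rw [← LinearMap.range_eq_top, eq_top_iff, ← (Pi.basisFun 𝕜 _).span_eq, Submodule.span_le]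
    rintro _ ⟨⟨i, j, j'⟩, rfl⟩
    obtain ⟨Φ, hΦeq, c, hc, hΦu⟩ := hΦ i j j'
    have hd : star (u ⟨i, j'⟩) ⬝ᵥ u ⟨i, j'⟩ ≠ 0 := fun h =>
      h0 _ _ (star_dotProduct_self_eq_zero.1 h)
    refine ⟨(c * (star (u ⟨i, j'⟩) ⬝ᵥ u ⟨i, j'⟩))⁻¹ •
      ⟨Φ ∘ₗ P ⟨i, j⟩, fun g f => by simp only [LinearMap.comp_apply, hPeq, hΦeq g]⟩, ?_⟩
    ext ⟨a, b, b'⟩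
    rw [F.map_smul, Pi.smul_apply]
    change _ • (star (u ⟨a, b'⟩) ⬝ᵥ Φ (P ⟨i, j⟩ (u ⟨a, b⟩))) = _
    rw [Pi.basisFun_apply, Pi.single_apply]
    by_cases h : (⟨a, b⟩ : Σ i, J i) = ⟨i, j⟩
    · cases h
      rw [hPid _ _ (hu _), show Φ (u ⟨i, j⟩) = c • u ⟨i, j'⟩ from hΦu, dotProduct_smul]
      by_cases hb : b' = j'
      · subst hb
        rw [if_pos rfl, smul_eq_mul, smul_eq_mul, inv_mul_cancel₀ (mul_ne_zero hc hd)]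
      · rw [hVorth ⟨i, b'⟩ ⟨i, j'⟩ (by simpa using hb) _ (hu _) _ (hu _), smul_zero, smul_zero,
          if_neg (by simpa using hb)]
    · rw [hPV _ _ (Ne.symm h) _ (hu _), map_zero, dotProduct_zero, smul_zero, if_neg]
      rintro h'
      cases h'
      exact h rfl
  have hFinj : ∀ T, F T = 0 → T = 0 := by
    have h1 := finrank_equivariantEnd_le (𝕜 := 𝕜) κ hκ
    have h2 : Module.finrank 𝕜 (equivariantEnd 𝕜 G X) =
        Module.finrank 𝕜 ((Σ i, J i × J i) → 𝕜) := by
      refine le_antisymm (by rwa [Module.finrank_fintype_fun_eq_card]) ?_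
      exact LinearMap.finrank_le_finrank_of_surjective hFsurj
    exact fun T hT => (LinearMap.injective_iff_surjective_of_finrank_eq_finrank h2).2 hFsurj
      (hT.trans F.map_zero.symm)
  have key : ∀ T ∈ equivariantEnd 𝕜 G X,
      (∀ i j j', star (u ⟨i, j'⟩) ⬝ᵥ T (u ⟨i, j⟩) = 0) → T = 0 := fun T hT h =>
    congrArg Subtype.val (hFinj ⟨T, hT⟩ (funext fun z => h z.1 z.2.1 z.2.2))
  refine ⟨hJ, fun i j => V ⟨i, j⟩, ?_, ?_, ?_, hVorth, ?_, fun i j => hu ⟨i, j⟩, h0, ?_⟩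
  · -- The projection onto an invariant subspace of `V i j` is a multiple of the one onto `V i j`.
    intro i j
    have hne : u ⟨i, j⟩ ≠ 0 := h0 i j
    refine @IsSimpleOrder.mk _ _ _ ⟨⟨⊥, ⊤, fun h => ?_⟩⟩ fun S => ?_
    · have h1 : (⟨u ⟨i, j⟩, hu _⟩ : (V ⟨i, j⟩).toSubmodule) ∈
          (⊥ : Subrepresentation (V ⟨i, j⟩).toRepresentation) := by
        rw [h]
        exact Submodule.mem_top
      exact hne (congrArg Subtype.val ((Submodule.mem_bot 𝕜).1 h1))
    · let S' : Subrepresentation (permRep 𝕜 G X) :=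
        { toSubmodule := S.toSubmodule.map (V ⟨i, j⟩).toSubmodule.subtype
          apply_mem_toSubmodule := by
            rintro g _ ⟨v, hv, rfl⟩
            exact ⟨_, S.apply_mem_toSubmodule g hv, rfl⟩ }
      have hS' : S'.toSubmodule ≤ (V ⟨i, j⟩).toSubmodule := Submodule.map_subtype_le _ _
      obtain ⟨Q, hQeq, hQmem, hQid, hQker, -⟩ := exists_equivariant_projection S'
      have hd : star (u ⟨i, j⟩) ⬝ᵥ u ⟨i, j⟩ ≠ 0 := fun h =>
        hne (star_dotProduct_self_eq_zero.1 h)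
      obtain ⟨c, hc⟩ : ∃ c : 𝕜, c * (star (u ⟨i, j⟩) ⬝ᵥ u ⟨i, j⟩) =
          star (u ⟨i, j⟩) ⬝ᵥ Q (u ⟨i, j⟩) := ⟨_, div_mul_cancel₀ _ hd⟩
      have hQP : Q - c • P ⟨i, j⟩ = 0 := by
        refine key _ (fun g f => ?_) fun a b b' => ?_
        · simp only [LinearMap.sub_apply, LinearMap.smul_apply, hQeq, hPeq, map_sub, map_smul]
        · rw [LinearMap.sub_apply, LinearMap.smul_apply, dotProduct_sub, dotProduct_smul]
          by_cases h : (⟨a, b⟩ : Σ i, J i) = ⟨i, j⟩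
          · cases h
            rw [hPid _ _ (hu _)]
            by_cases hb : b' = j
            · subst hb
              rw [smul_eq_mul, hc, sub_self]
            · have hp : (⟨i, b'⟩ : Σ i, J i) ≠ ⟨i, j⟩ := by simpa using hb
              rw [hVorth _ _ hp _ (hu _) _ (hS' (hQmem _)), hVorth _ _ hp _ (hu _) _ (hu _),
                smul_zero, sub_zero]
          · rw [hPV _ _ (Ne.symm h) _ (hu _), hQker _ fun s hs =>
              hVorth _ _ (Ne.symm h) _ (hS' hs) _ (hu _)]
            simp
      rw [sub_eq_zero] at hQP
      by_cases h : c = 0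
      · left
        refine Subrepresentation.toSubmodule_injective (le_bot_iff.1 fun v hv => ?_)
        have h1 := hQid v.1 ⟨v, hv, rfl⟩
        rw [hQP, h, zero_smul, LinearMap.zero_apply] at h1
        exact (Submodule.mem_bot 𝕜).2 (Subtype.ext h1.symm)
      · right
        refine Subrepresentation.toSubmodule_injective (top_le_iff.1 fun v _ => ?_)
        have h1 : c • v.1 ∈ S'.toSubmodule := by
          have h2 := hQmem v.1
          rwa [hQP, LinearMap.smul_apply, hPid _ _ v.2] at h2
        obtain ⟨w, hw, hwv⟩ := (Submodule.smul_mem_iff _ h).1 h1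
        rwa [← Subtype.ext hwv]
  · intro p
    rw [Submodule.disjoint_def]
    intro v hv hv'
    have h1 : (⨆ q, ⨆ (_ : q ≠ p), (V q).toSubmodule) ≤ LinearMap.ker (P p) :=
      iSup₂_le fun q hq v hv => hPV p q hq.symm v hv
    rw [← hPid p v hv]
    exact h1 hv'
  · -- The projection onto the complement of the sum of all `V i j` vanishes.
    let S : Subrepresentation (permRep 𝕜 G X) :=
      { toSubmodule := ⨆ p, (V p).toSubmodule
        apply_mem_toSubmodule := fun g v hv => by
          refine (iSup_le fun p w hw => ?_ : (⨆ p, (V p).toSubmodule) ≤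
            (⨆ p, (V p).toSubmodule).comap (permRep 𝕜 G X g)) hv
          exact Submodule.mem_iSup_of_mem p ((V p).apply_mem_toSubmodule g hw) }
    obtain ⟨Q, hQeq, hQmem, hQid, -, -⟩ := exists_equivariant_projection S
    have h1 : LinearMap.id - Q = 0 := by
      refine key _ (fun g f => ?_) fun a b b' => ?_
      · simp only [LinearMap.sub_apply, LinearMap.id_apply, hQeq, map_sub]
      · rw [LinearMap.sub_apply, LinearMap.id_apply,
          hQid _ (Submodule.mem_iSup_of_mem _ (hu _)), sub_self, dotProduct_zero]
    rw [sub_eq_zero] at h1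
    refine top_le_iff.1 fun v _ => ?_
    have h2 := hQmem v
    rwa [← h1] at h2
  · intro i i' j j'
    constructor
    · rintro ⟨φ⟩
      by_contra hne
      have hpq : ∀ b, (⟨i, b⟩ : Σ i, J i) ≠ ⟨i', j'⟩ := fun b h => hne (congrArg Sigma.fst h)
      let T : (X → 𝕜) →ₗ[𝕜] (X → 𝕜) := (V ⟨i', j'⟩).toSubmodule.subtype ∘ₗ
        φ.toLinearEquiv.toLinearMap ∘ₗ (P ⟨i, j⟩).codRestrict _ (hPmem ⟨i, j⟩)
      have hT : T = 0 := by
        refine key _ (fun g f => ?_) fun a b b' => ?_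
        · have h1 : (P ⟨i, j⟩).codRestrict _ (hPmem ⟨i, j⟩) (permRep 𝕜 G X g f) =
              (V ⟨i, j⟩).toRepresentation g
                ((P ⟨i, j⟩).codRestrict _ (hPmem ⟨i, j⟩) f) := Subtype.ext (hPeq _ g f)
          simp only [T, LinearMap.comp_apply, h1]
          exact congrArg Subtype.val (LinearMap.congr_fun (φ.isIntertwining' g) _)
        · by_cases h : (⟨a, b⟩ : Σ i, J i) = ⟨i, j⟩
          · cases h
            exact hVorth _ _ (hpq b') _ (hu _) _ (Subtype.prop _)
          · have h1 : (P ⟨i, j⟩).codRestrict _ (hPmem ⟨i, j⟩) (u ⟨a, b⟩) = 0 :=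
              Subtype.ext (hPV _ _ (Ne.symm h) _ (hu _))
            simp only [T, LinearMap.comp_apply, h1, map_zero, dotProduct_zero]
      have h1 : (P ⟨i, j⟩).codRestrict _ (hPmem ⟨i, j⟩) (u ⟨i, j⟩) = ⟨u ⟨i, j⟩, hu _⟩ :=
        Subtype.ext (hPid _ _ (hu _))
      have h2 := LinearMap.congr_fun hT (u ⟨i, j⟩)
      simp only [T, LinearMap.comp_apply, h1, LinearMap.zero_apply] at h2
      have h3 := φ.toLinearEquiv.map_eq_zero_iff.1 (Subtype.ext h2)
      exact h0 i j (congrArg Subtype.val h3)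
    · rintro rfl
      obtain ⟨φ, -⟩ := exists_equiv_cyclicSubrep (hΦ i j j') (hΦ i j' j)
      exact ⟨φ⟩
  · intro i j j'
    exact exists_equiv_cyclicSubrep (hΦ i j j') (hΦ i j' j)

end Criterion

/-! ### Products of differences on words -/

section Words

variable {ι A : Type*}

/-- The transformation of words that permutes the coordinates and the letters in each
coordinate. -/
def wordMap (ρ : Equiv.Perm ι) (t : ι → Equiv.Perm A) (x : ι → A) : ι → A :=
  fun i => t i (x (ρ i))

lemma update_wordMap [DecidableEq ι] (ρ : Equiv.Perm ι) (t : ι → Equiv.Perm A) (x : ι → A) (i : ι)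
    (c : A) :
    Function.update (wordMap ρ t x) i (t i c) = wordMap ρ t (Function.update x (ρ i) c) := by
  ext j
  by_cases h : j = i
  · subst h
    simp [wordMap]
  · rw [Function.update_of_ne h, wordMap, wordMap,
      Function.update_of_ne fun h' => h (ρ.injective h')]

variable [Zero A] [DecidableEq A]

/-- The indicator of the nonzero letters. -/
def nz (c : A) : ℤ := if c = 0 then 0 else 1

lemma nz_zero : nz (0 : A) = 0 := if_pos rfl

lemma nz_of_ne_zero {c : A} (h : c ≠ 0) : nz c = 1 := if_neg h

lemma nz_perm {t : Equiv.Perm A} (ht : t 0 = 0) (c : A) : nz (t c) = nz c := by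
  have h : t c = 0 ↔ c = 0 := by rw [← ht, t.apply_eq_iff_eq, ht]
  simp [nz, h]

/-- `k` ordered pairs `(a j, b j)` of coordinates and a set `L` of coordinates, all disjoint. -/
structure PairData (ι : Type*) where
  /-- The number of pairs. -/
  k : ℕ
  /-- The first members of the pairs. -/
  a : Fin k → ι
  /-- The second members of the pairs. -/
  b : Fin k → ι
  /-- A set of coordinates outside the pairs, at which words will be weighted by a function of the
  letter. -/
  L : Finset ι
  a_inj : Function.Injective a
  b_inj : Function.Injective b
  a_ne_b : ∀ i j, a i ≠ b j
  a_notMem : ∀ j, a j ∉ L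
  b_notMem : ∀ j, b j ∉ L

namespace PairData

/-- The image of the coordinates under a permutation. -/
@[simps]
def map (D : PairData ι) (ρ : Equiv.Perm ι) : PairData ι where
  k := D.k
  a j := ρ (D.a j)
  b j := ρ (D.b j)
  L := D.L.map ρ.toEmbedding
  a_inj := ρ.injective.comp D.a_inj
  b_inj := ρ.injective.comp D.b_inj
  a_ne_b i j h := D.a_ne_b i j (ρ.injective h)
  a_notMem j h := D.a_notMem j (by simpa using h)
  b_notMem j h := D.b_notMem j (by simpa using h)

/-- The difference of the indicators at the two members of a pair. -/
def diff (D : PairData ι) (x : ι → A) (j : Fin D.k) : ℤ := nz (x (D.b j)) - nz (x (D.a j))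

/-- The product of the differences over all pairs and of the letter weights `ε` over `L`. -/
def poly (D : PairData ι) (ε : A → ℤ) (x : ι → A) : ℤ :=
  (∏ j, D.diff x j) * ∏ i ∈ D.L, ε (x i)

/-- The restriction of `poly` to the words of weight `w`. -/
def slice [Fintype ι] (D : PairData ι) (ε : A → ℤ) (w : ℕ) (x : ι → A) : ℤ :=
  if hammingNorm x = w then D.poly ε x else 0

end PairData

lemma hammingNorm_eq_sum_nz [Fintype ι] (x : ι → A) : (hammingNorm x : ℤ) = ∑ i, nz (x i) := by
  simp [hammingNorm, nz, Finset.card_filter, ite_not]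

lemma hammingNorm_eq_of_sum_nz [Fintype ι] {x y : ι → A} (h : ∑ i, nz (x i) = ∑ i, nz (y i)) :
    hammingNorm x = hammingNorm y := by
  rw [← hammingNorm_eq_sum_nz, ← hammingNorm_eq_sum_nz] at h
  exact_mod_cast h

lemma hammingNorm_wordMap [Fintype ι] (ρ : Equiv.Perm ι) {t : ι → Equiv.Perm A}
    (ht : ∀ i, t i 0 = 0) (x : ι → A) : hammingNorm (wordMap ρ t x) = hammingNorm x := by
  refine hammingNorm_eq_of_sum_nz ?_
  simp only [wordMap, nz_perm (ht _)]
  exact Equiv.sum_comp ρ fun i => nz (x i)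

lemma hammingNorm_update [Fintype ι] [DecidableEq ι] (x : ι → A) (i : ι) (c : A) :
    (hammingNorm (Function.update x i c) : ℤ) = hammingNorm x - nz (x i) + nz c := by
  rw [hammingNorm_eq_sum_nz, hammingNorm_eq_sum_nz, ← Finset.add_sum_erase _ _ (Finset.mem_univ i),
    ← Finset.add_sum_erase (a := i) _ (fun i => nz (x i)) (Finset.mem_univ i),
    Finset.sum_congr rfl fun j hj => by
      rw [Function.update_of_ne (Finset.ne_of_mem_erase hj)]]
  rw [Function.update_self]
  ring

namespace PairData

variable (D : PairData ι) {ε : A → ℤ}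

lemma poly_congr {x y : ι → A} (h : ∀ j, D.diff x j = D.diff y j)
    (hL : ∀ i ∈ D.L, ε (x i) = ε (y i)) : D.poly ε x = D.poly ε y := by
  rw [poly, poly, Finset.prod_congr rfl fun j _ => h j, Finset.prod_congr rfl hL]

/-- Coordinate and letter permutations turn the function `slice` into the one of the image data,
up to a sign. -/
lemma exists_slice_wordMap [Fintype ι] (ρ : Equiv.Perm ι) {t : ι → Equiv.Perm A}
    (ht : ∀ i, t i 0 = 0) (hε : ∀ i, ∃ s : ℤ, ∀ c, ε (t i c) = s * ε c) (w : ℕ) :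
    ∃ s : ℤ, ∀ x, D.slice ε w (wordMap ρ t x) = s * (D.map ρ).slice ε w x := by
  choose s hs using hε
  refine ⟨∏ i ∈ D.L, s i, fun x => ?_⟩
  rw [slice, slice, hammingNorm_wordMap ρ ht, mul_ite, mul_zero]
  refine if_congr Iff.rfl ?_ rfl
  rw [poly, poly, map_L, Finset.prod_map, ← mul_assoc, mul_comm (∏ i ∈ D.L, s i), mul_assoc,
    ← Finset.prod_mul_distrib]
  congr 1
  · refine Finset.prod_congr rfl fun j _ => ?_
    simp only [diff, wordMap, nz_perm (ht _), map_a, map_b]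
  · exact Finset.prod_congr rfl fun i _ => hs i _

/-- Words with nonzero letters at `b j` and on `L`, zeros at `a j` and arbitrary letters elsewhere
realize all weights between `k + |L|` and `n - k`. -/
lemma exists_slice_ne_zero [Fintype ι] [DecidableEq ι] {c : A} (hc : c ≠ 0)
    (hε : ∀ i ∈ D.L, ε c ≠ 0) {w : ℕ} (h1 : D.k + D.L.card ≤ w) (h2 : w + D.k ≤ Fintype.card ι) :
    ∃ x, D.slice ε w x ≠ 0 := by
  have hs : (Finset.univ.image D.b ∪ D.L).card = D.k + D.L.card := by
    rw [Finset.card_union_of_disjoint, Finset.card_image_of_injective _ D.b_inj, Finset.card_univ,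
      Fintype.card_fin]
    rw [Finset.disjoint_left]
    intro i hi
    obtain ⟨j, -, rfl⟩ := Finset.mem_image.1 hi
    exact D.b_notMem j
  have ht : ((Finset.univ.image D.a)ᶜ).card = Fintype.card ι - D.k := by
    rw [Finset.card_compl, Finset.card_image_of_injective _ D.a_inj, Finset.card_univ,
      Fintype.card_fin]
  obtain ⟨T, hT1, hT2, hT3⟩ := Finset.exists_subsuperset_card_eq (n := w)
    (s := Finset.univ.image D.b ∪ D.L) (t := (Finset.univ.image D.a)ᶜ) (by
      intro i hi
      rw [Finset.mem_compl, Finset.mem_image]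
      rintro ⟨j, -, rfl⟩
      rcases Finset.mem_union.1 hi with h | h
      · obtain ⟨j', -, h⟩ := Finset.mem_image.1 h
        exact D.a_ne_b j j' h.symm
      · exact D.a_notMem j h) (by omega) (by omega)
  refine ⟨fun i => if i ∈ T then c else 0, ?_⟩
  rw [slice, if_pos, poly]
  · refine mul_ne_zero (Finset.prod_ne_zero_iff.2 fun j _ => ?_)
      (Finset.prod_ne_zero_iff.2 fun i hi => ?_)
    · have hb : D.b j ∈ T := hT1 (Finset.mem_union_left _ (Finset.mem_image_of_mem _ (by simp)))
      have ha : D.a j ∉ T := fun h => by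
        have := hT2 h
        simp at this
      simp [diff, hb, ha, nz, hc]
    · rw [if_pos (hT1 (Finset.mem_union_right _ hi))]
      exact hε i hi
  · simp [hammingNorm, hc, hT3]

/-! ### Orthogonality of slices -/

section Orthogonality

variable [DecidableEq ι]

lemma sum_eq_zero_of_comp_eq_neg {X : Type*} [Fintype X] (e : Equiv.Perm X) {F : X → ℤ}
    (h : ∀ x, F (e x) = -F x) : ∑ x, F x = 0 := by
  have h1 := Equiv.sum_comp e F
  simp only [h, Finset.sum_neg_distrib] at h1
  omega

/-- A letter permutation that negates `ε`, applied at a coordinate of `L`, negates `poly`. -/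
lemma poly_update_neg {s : Equiv.Perm A} (hs : ∀ c, ε (s c) = -ε c) {i : ι}
    (hi : i ∈ D.L) (x : ι → A) : D.poly ε (Function.update x i (s (x i))) = -D.poly ε x := by
  rw [poly, poly, ← mul_neg, ← Finset.mul_prod_erase _ _ hi, ← Finset.mul_prod_erase _ _ hi,
    Function.update_self, hs, neg_mul]
  congr 1
  · refine Finset.prod_congr rfl fun j _ => ?_
    have ha : D.a j ≠ i := fun h => D.a_notMem j (h ▸ hi)
    have hb : D.b j ≠ i := fun h => D.b_notMem j (h ▸ hi)
    rw [diff, diff, Function.update_of_ne ha, Function.update_of_ne hb]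
  · congr 2
    refine Finset.prod_congr rfl fun j hj => ?_
    rw [Function.update_of_ne (Finset.ne_of_mem_erase hj)]


lemma poly_update_perm {s : Equiv.Perm A} (hs0 : s 0 = 0) {i : ι}
    (hi : i ∉ D.L) (x : ι → A) : D.poly ε (Function.update x i (s (x i))) = D.poly ε x := by
  have h : ∀ j, nz (Function.update x i (s (x i)) j) = nz (x j) := fun j => by
    by_cases hj : j = i
    · subst hj
      rw [Function.update_self, nz_perm hs0]
    · rw [Function.update_of_ne hj]
  refine D.poly_congr (fun j => by rw [diff, diff, h, h]) fun j hj => ?_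
  rw [Function.update_of_ne]
  rintro rfl
  exact hi hj

/-- The involution applying the letter permutation `s` at the coordinate `i`. -/
def flipAt (s : Equiv.Perm A) (hs : ∀ c, s (s c) = c) (i : ι) : Equiv.Perm (ι → A) :=
  Function.Involutive.toPerm (fun x => Function.update x i (s (x i))) fun x => by simp [hs]

variable [Fintype ι] [Fintype A]

lemma sum_slice_mul_slice_of_mem {D E : PairData ι} {s : Equiv.Perm A} (hs0 : s 0 = 0)
    (hs2 : ∀ c, s (s c) = c) (hs : ∀ c, ε (s c) = -ε c) {i : ι} (hi : i ∈ D.L) (hi' : i ∉ E.L)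
    (w w' : ℕ) : ∑ x, D.slice ε w x * E.slice ε w' x = 0 := by
  refine sum_eq_zero_of_comp_eq_neg (flipAt s hs2 i) fun x => ?_
  have h : hammingNorm (flipAt s hs2 i x) = hammingNorm x := by
    have := hammingNorm_update x i (s (x i))
    rw [nz_perm hs0] at this
    have h' : hammingNorm (flipAt s hs2 i x) = hammingNorm (Function.update x i (s (x i))) := rfl
    omega
  have h1 : D.poly ε (flipAt s hs2 i x) = - D.poly ε x := D.poly_update_neg hs hi x
  have h2 : E.poly ε (flipAt s hs2 i x) = E.poly ε x := E.poly_update_perm hs0 hi' x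
  rw [slice, slice, slice, slice, h, h1, h2]
  split_ifs <;> ring

/-- If `L` is the same set but the numbers of pairs differ, then the slices are orthogonal: every
monomial of the product with fewer pairs misses both members of some pair of the other one, and
exchanging these two coordinates changes the sign of the other product only. -/
lemma sum_slice_mul_slice_of_lt {D E : PairData ι} (hk : D.k < E.k) (hL : D.L = E.L)
    (w w' : ℕ) : ∑ x, D.slice ε w x * E.slice ε w' x = 0 := by
  have hexp : ∀ x : ι → A, D.poly ε x = ∑ t : Finset (Fin D.k),
      ((∏ j ∈ t, nz (x (D.b j))) * ∏ j ∈ tᶜ, -nz (x (D.a j))) * ∏ i ∈ D.L, ε (x i) := by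
    intro x
    simp only [poly, diff, sub_eq_add_neg]
    rw [Finset.prod_add, Finset.sum_mul, Finset.powerset_univ]
    rfl
  have hF : ∀ x : ι → A, D.slice ε w x * E.slice ε w' x = ∑ t : Finset (Fin D.k),
      if hammingNorm x = w ∧ hammingNorm x = w' then
        (((∏ j ∈ t, nz (x (D.b j))) * ∏ j ∈ tᶜ, -nz (x (D.a j))) * ∏ i ∈ D.L, ε (x i)) *
          E.poly ε x else 0 := by
    intro x
    rw [slice, slice, ite_zero_mul_ite_zero, hexp, Finset.sum_mul]
    split_ifs
    · rfl
    · rw [Finset.sum_const_zero]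
  simp only [hF]
  rw [Finset.sum_comm]
  refine Finset.sum_eq_zero fun t _ => ?_
  obtain ⟨j, hj⟩ : ∃ j, E.a j ∉ t.image D.b ∪ tᶜ.image D.a ∧
      E.b j ∉ t.image D.b ∪ tᶜ.image D.a := by
    by_contra! hcon
    have hcard : (t.image D.b ∪ tᶜ.image D.a).card ≤ D.k := by
      refine (Finset.card_union_le _ _).trans ?_
      have h1 : t.card + tᶜ.card = D.k := by rw [Finset.card_add_card_compl, Fintype.card_fin]
      have h2 := Finset.card_image_le (s := t) (f := D.b)
      have h3 := Finset.card_image_le (s := tᶜ) (f := D.a)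
      omega
    let c : Fin E.k → ι := fun j =>
      if E.a j ∈ t.image D.b ∪ tᶜ.image D.a then E.a j else E.b j
    have hc : Function.Injective c := by
      intro i j hij
      simp only [c] at hij
      split_ifs at hij
      · exact E.a_inj hij
      · exact absurd hij (E.a_ne_b _ _)
      · exact absurd hij.symm (E.a_ne_b _ _)
      · exact E.b_inj hij
    have h4 : (Finset.univ.image c).card ≤ (t.image D.b ∪ tᶜ.image D.a).card := by
      refine Finset.card_le_card fun i hi => ?_
      obtain ⟨j, -, rfl⟩ := Finset.mem_image.1 hi
      simp only [c]
      split_ifs with h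
      · exact h
      · exact hcon j h
    rw [Finset.card_image_of_injective _ hc, Finset.card_univ, Fintype.card_fin] at h4
    omega
  refine sum_eq_zero_of_comp_eq_neg
    ((Equiv.swap (E.a j) (E.b j)).arrowCongr (Equiv.refl A)) fun x => ?_
  have hx : ∀ i, ((Equiv.swap (E.a j) (E.b j)).arrowCongr (Equiv.refl A)) x i =
      x (Equiv.swap (E.a j) (E.b j) i) := fun i => rfl
  have hn : hammingNorm (((Equiv.swap (E.a j) (E.b j)).arrowCongr (Equiv.refl A)) x) =
      hammingNorm x := by
    refine hammingNorm_eq_of_sum_nz ?_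
    simp only [hx]
    exact Equiv.sum_comp (Equiv.swap (E.a j) (E.b j)) fun i => nz (x i)
  have hE : E.poly ε (((Equiv.swap (E.a j) (E.b j)).arrowCongr (Equiv.refl A)) x) =
      -E.poly ε x := by
    rw [poly, poly, ← neg_mul, ← Finset.mul_prod_erase _ _ (Finset.mem_univ j),
      ← Finset.mul_prod_erase _ _ (Finset.mem_univ j), ← neg_mul]
    congr 1
    · congr 1
      · simp only [diff, hx, Equiv.swap_apply_left, Equiv.swap_apply_right]
        ring
      · refine Finset.prod_congr rfl fun i hi => ?_
        have hij := Finset.ne_of_mem_erase hi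
        rw [diff, diff, hx, hx, Equiv.swap_apply_of_ne_of_ne, Equiv.swap_apply_of_ne_of_ne]
        · exact fun h => hij (E.a_inj h)
        · exact E.a_ne_b _ _
        · exact fun h => E.a_ne_b _ _ h.symm
        · exact fun h => hij (E.b_inj h)
    · refine Finset.prod_congr rfl fun i hi => ?_
      rw [hx, Equiv.swap_apply_of_ne_of_ne]
      · rintro rfl
        exact E.a_notMem _ hi
      · rintro rfl
        exact E.b_notMem _ hi
  rw [Finset.mem_union, Finset.mem_union, Finset.mem_image, Finset.mem_image, Finset.mem_image,
    Finset.mem_image] at hj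
  push Not at hj
  obtain ⟨⟨h1, h2⟩, h3, h4⟩ := hj
  rw [hn, hE, Finset.prod_congr rfl fun i hi => by
      rw [hx, Equiv.swap_apply_of_ne_of_ne (h1 i hi) (h3 i hi)],
    Finset.prod_congr (s₁ := tᶜ) rfl fun i hi => by
      rw [hx, Equiv.swap_apply_of_ne_of_ne (h2 i hi) (h4 i hi)],
    Finset.prod_congr (s₁ := D.L) rfl fun i hi => by
      rw [hx, Equiv.swap_apply_of_ne_of_ne
        (fun h => E.a_notMem j (by rwa [← hL, ← h])) fun h => E.b_notMem j (by rwa [← hL, ← h])]]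
  split_ifs <;> ring

end Orthogonality

/-! ### Raising and lowering the weight -/

section Shift

variable [DecidableEq ι]

/-- At a coordinate of `L` the product depends on the letter `c` through the factor `ε c`. -/
lemma exists_poly_update_mem {i : ι} (hi : i ∈ D.L) (x : ι → A) :
    ∃ q : ℤ, ∀ c, D.poly ε (Function.update x i c) = ε c * q := by
  refine ⟨(∏ j, D.diff x j) * ∏ i ∈ D.L.erase i, ε (x i), fun c => ?_⟩
  rw [poly, ← Finset.mul_prod_erase _ _ hi, Function.update_self, mul_left_comm]
  congr 2
  · refine Finset.prod_congr rfl fun j _ => ?_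
    have ha : D.a j ≠ i := fun h => D.a_notMem j (h ▸ hi)
    have hb : D.b j ≠ i := fun h => D.b_notMem j (h ▸ hi)
    rw [diff, diff, Function.update_of_ne ha, Function.update_of_ne hb]
  · refine Finset.prod_congr rfl fun j hj => ?_
    rw [Function.update_of_ne (Finset.ne_of_mem_erase hj)]

/-- Changing a letter at one member of a pair changes the factor of this pair only. -/
lemma exists_poly_update_pair (j : Fin D.k) (x : ι → A) : ∃ q : ℤ, ∀ c,
    D.poly ε (Function.update x (D.a j) c) = (nz (x (D.b j)) - nz c) * q ∧
    D.poly ε (Function.update x (D.b j) c) = (nz c - nz (x (D.a j))) * q := by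
  refine ⟨(∏ i ∈ Finset.univ.erase j, D.diff x i) * ∏ i ∈ D.L, ε (x i), fun c => ⟨?_, ?_⟩⟩
  · rw [poly, ← Finset.mul_prod_erase _ _ (Finset.mem_univ j), mul_assoc, diff,
      Function.update_self, Function.update_of_ne (D.a_ne_b _ _).symm]
    congr 2
    · refine Finset.prod_congr rfl fun i hi => ?_
      rw [diff, diff, Function.update_of_ne (D.a_ne_b _ _).symm,
        Function.update_of_ne fun h => Finset.ne_of_mem_erase hi (D.a_inj h)]
    · refine Finset.prod_congr rfl fun i hi => ?_
      rw [Function.update_of_ne fun h => D.a_notMem j (by rwa [← h])]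
  · rw [poly, ← Finset.mul_prod_erase _ _ (Finset.mem_univ j), mul_assoc, diff,
      Function.update_self, Function.update_of_ne (D.a_ne_b _ _)]
    congr 2
    · refine Finset.prod_congr rfl fun i hi => ?_
      rw [diff, diff, Function.update_of_ne (D.a_ne_b _ _),
        Function.update_of_ne fun h => Finset.ne_of_mem_erase hi (D.b_inj h)]
    · refine Finset.prod_congr rfl fun i hi => ?_
      rw [Function.update_of_ne fun h => D.b_notMem j (by rwa [← h])]

variable [Fintype ι]

/-- The coordinates outside the pairs and `L`. -/
def rest (D : PairData ι) : Finset ι :=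
  (Finset.univ.image D.a ∪ Finset.univ.image D.b ∪ D.L)ᶜ

lemma sum_eq_pairs_add (f : ι → ℤ) :
    ∑ i, f i = ∑ j, (f (D.a j) + f (D.b j)) + ∑ i ∈ D.L, f i + ∑ i ∈ D.rest, f i := by
  rw [← Finset.sum_add_sum_compl (Finset.univ.image D.a ∪ Finset.univ.image D.b ∪ D.L), rest,
    Finset.sum_union, Finset.sum_union, Finset.sum_image D.a_inj.injOn,
    Finset.sum_image D.b_inj.injOn, Finset.sum_add_distrib]
  · rw [Finset.disjoint_left]
    intro i hi hi'
    obtain ⟨j, -, rfl⟩ := Finset.mem_image.1 hi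
    obtain ⟨j', -, h⟩ := Finset.mem_image.1 hi'
    exact D.a_ne_b j j' h.symm
  · rw [Finset.disjoint_left]
    intro i hi
    rcases Finset.mem_union.1 hi with h | h
    · obtain ⟨j, -, rfl⟩ := Finset.mem_image.1 h
      exact D.a_notMem j
    · obtain ⟨j, -, rfl⟩ := Finset.mem_image.1 h
      exact D.b_notMem j

lemma poly_update_rest {i : ι} (hi : i ∈ D.rest) (c : A) (x : ι → A) :
    D.poly ε (Function.update x i c) = D.poly ε x := by
  simp only [rest, Finset.mem_compl, Finset.mem_union, Finset.mem_image, Finset.mem_univ, true_and,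
    not_or, not_exists] at hi
  refine D.poly_congr (fun j => ?_) fun j hj => ?_
  · rw [diff, diff, Function.update_of_ne (hi.1.1 j), Function.update_of_ne (hi.1.2 j)]
  · rw [Function.update_of_ne]
    rintro rfl
    exact hi.2 hj

/-- Where the product does not vanish, exactly one member of each pair and all members of `L` are
nonzero. -/
lemma sum_rest_mul_poly (h0 : ε 0 = 0) (x : ι → A) :
    (∑ i ∈ D.rest, nz (x i)) * D.poly ε x =
      (hammingNorm x - D.k - D.L.card) * D.poly ε x := by
  by_cases hp : D.poly ε x = 0
  · rw [hp, mul_zero, mul_zero]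
  congr 1
  obtain ⟨h1, h2⟩ := mul_ne_zero_iff.1 hp
  rw [Finset.prod_ne_zero_iff] at h1 h2
  have h3 : ∑ j, (nz (x (D.a j)) + nz (x (D.b j))) = D.k := by
    rw [Finset.sum_congr rfl fun j hj => show _ = (1 : ℤ) from ?_]
    · simp
    · have := h1 j hj
      unfold diff nz at this
      unfold nz
      split_ifs at this ⊢ <;> simp_all
  have h4 : ∑ i ∈ D.L, nz (x i) = D.L.card := by
    rw [Finset.sum_congr rfl fun i hi => nz_of_ne_zero fun h => h2 i hi (by rw [h, h0])]
    simp
  have := D.sum_eq_pairs_add fun i => nz (x i)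
  rw [hammingNorm_eq_sum_nz, this, h3, h4]
  ring

lemma card_rest : (D.rest.card : ℤ) = Fintype.card ι - 2 * D.k - D.L.card := by
  have := D.sum_eq_pairs_add fun _ => 1
  simp at this
  rw [this]
  ring

/-- Summing the product over all ways to replace a nonzero letter by zero. -/
lemma sum_poly_update_zero (h0 : ε 0 = 0) (x : ι → A) :
    ∑ i, nz (x i) * D.poly ε (Function.update x i 0) =
      (hammingNorm x - D.k - D.L.card) * D.poly ε x := by
  rw [D.sum_eq_pairs_add, Finset.sum_eq_zero, Finset.sum_eq_zero, ← sum_rest_mul_poly D h0,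
    Finset.sum_mul, zero_add, zero_add]
  · exact Finset.sum_congr rfl fun i hi => by rw [D.poly_update_rest hi]
  · intro i hi
    obtain ⟨q, hq⟩ := D.exists_poly_update_mem (ε := ε) hi x
    rw [hq, h0, zero_mul, mul_zero]
  · intro j _
    obtain ⟨q, hq⟩ := D.exists_poly_update_pair (ε := ε) j x
    rw [(hq 0).1, (hq 0).2, nz_zero]
    ring

lemma sum_slice_update_zero (h0 : ε 0 = 0) (w : ℕ) (x : ι → A) :
    ∑ i, nz (x i) * D.slice ε w (Function.update x i 0) =
      (w + 1 - D.k - D.L.card) * D.slice ε (w + 1) x := by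
  have h : ∀ i, nz (x i) * D.slice ε w (Function.update x i 0) =
      if hammingNorm x = w + 1 then nz (x i) * D.poly ε (Function.update x i 0) else 0 := by
    intro i
    by_cases hi : x i = 0
    · simp [hi, nz_zero]
    · have h1 := hammingNorm_update x i 0
      rw [nz_of_ne_zero hi, nz_zero] at h1
      have h2 : hammingNorm (Function.update x i 0) = w ↔ hammingNorm x = w + 1 := by omega
      rw [slice, if_congr h2 rfl rfl, mul_ite, mul_zero]
  simp only [h]
  rw [slice, mul_ite, mul_zero]
  split_ifs with hx
  · rw [D.sum_poly_update_zero h0, hx]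
    push_cast
    ring
  · rw [Finset.sum_const_zero]

variable [Fintype A]

/-- Summing the product over all ways to replace a zero by a nonzero letter. -/
lemma sum_poly_update_ne_zero (h0 : ε 0 = 0) (hsum : ∑ c, ε c = 0) (x : ι → A) :
    ∑ i, (1 - nz (x i)) * ∑ c, nz c * D.poly ε (Function.update x i c) =
      (∑ c : A, nz c) * (Fintype.card ι - hammingNorm x - D.k) * D.poly ε x := by
  have h1 : ∑ c, nz c * ε c = 0 := by
    rw [← hsum]
    refine Finset.sum_congr rfl fun c _ => ?_
    by_cases hc : c = 0
    · rw [hc, h0, mul_zero]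
    · rw [nz_of_ne_zero hc, one_mul]
  have hnz : ∀ c : A, nz c * nz c = nz c := fun c => by unfold nz; split_ifs <;> rfl
  rw [D.sum_eq_pairs_add, Finset.sum_eq_zero, Finset.sum_eq_zero, zero_add, zero_add]
  · have h2 := sum_rest_mul_poly D h0 x
    have h3 := D.card_rest
    calc _ = ∑ i ∈ D.rest, (1 - nz (x i)) * ((∑ c : A, nz c) * D.poly ε x) := by
          refine Finset.sum_congr rfl fun i hi => ?_
          simp only [D.poly_update_rest hi, Finset.sum_mul]
      _ = (∑ c : A, nz c) * ((D.rest.card : ℤ) * D.poly ε x -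
            (∑ i ∈ D.rest, nz (x i)) * D.poly ε x) := by
          rw [← Finset.sum_mul, Finset.sum_sub_distrib]
          simp
          ring
      _ = _ := by
          rw [h2, h3]
          ring
  · intro i hi
    obtain ⟨q, hq⟩ := D.exists_poly_update_mem (ε := ε) hi x
    simp only [hq, ← mul_assoc]
    rw [← Finset.sum_mul, h1, zero_mul, mul_zero]
  · intro j _
    obtain ⟨q, hq⟩ := D.exists_poly_update_pair (ε := ε) j x
    simp only [(hq _).1, (hq _).2, Finset.mul_sum, ← Finset.sum_add_distrib]
    refine Finset.sum_eq_zero fun c _ => ?_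
    linear_combination ((nz (x (D.a j)) - 1) * q + (1 - nz (x (D.b j))) * q) * hnz c

lemma sum_slice_update_ne_zero (h0 : ε 0 = 0) (hsum : ∑ c, ε c = 0) (w : ℕ) (x : ι → A) :
    ∑ i, (1 - nz (x i)) * ∑ c, nz c * D.slice ε (w + 1) (Function.update x i c) =
      (∑ c : A, nz c) * (Fintype.card ι - w - D.k) * D.slice ε w x := by
  have h : ∀ i, (1 - nz (x i)) * ∑ c, nz c * D.slice ε (w + 1) (Function.update x i c) =
      if hammingNorm x = w then (1 - nz (x i)) * ∑ c, nz c * D.poly ε (Function.update x i c)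
      else 0 := by
    intro i
    by_cases hi : x i = 0
    · have h2 : ∀ c, nz c * D.slice ε (w + 1) (Function.update x i c) =
          if hammingNorm x = w then nz c * D.poly ε (Function.update x i c) else 0 := by
        intro c
        by_cases hc : c = 0
        · simp [hc, nz_zero]
        · have h1 := hammingNorm_update x i c
          rw [hi, nz_of_ne_zero hc, nz_zero] at h1
          have h2 : hammingNorm (Function.update x i c) = w + 1 ↔ hammingNorm x = w := by omega
          rw [slice, if_congr h2 rfl rfl, mul_ite, mul_zero]
      simp only [h2]
      split_ifs
      · rfl
      · simp
    · simp [nz_of_ne_zero hi]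
  simp only [h]
  rw [slice, mul_ite, mul_zero]
  split_ifs with hx
  · rw [D.sum_poly_update_ne_zero h0 hsum, hx]
  · rw [Finset.sum_const_zero]

end Shift

end PairData

section Operators

variable (R : Type*) [CommRing R] [Fintype ι] [DecidableEq ι]

/-- The operator on functions of words that sums over all ways to replace a nonzero letter by
zero; it raises the weight of the support by one. -/
def raise : ((ι → A) → R) →ₗ[R] ((ι → A) → R) where
  toFun f x := ∑ i, (nz (x i) : R) * f (Function.update x i 0)
  map_add' f g := by
    ext x
    simp [mul_add, Finset.sum_add_distrib]
  map_smul' c f := by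
    ext x
    simp only [Pi.smul_apply, smul_eq_mul, RingHom.id_apply, Finset.mul_sum]
    exact Finset.sum_congr rfl fun i _ => by ring

lemma raise_slice (D : PairData ι) {ε : A → ℤ} (h0 : ε 0 = 0) (w : ℕ) :
    raise R (fun x => (D.slice ε w x : R)) =
      ((w + 1 - D.k - D.L.card : ℤ) : R) • fun x => (D.slice ε (w + 1) x : R) := by
  ext x
  have h := congrArg (Int.cast (R := R)) (D.sum_slice_update_zero h0 w x)
  simpa [raise] using h

lemma raise_comp_wordMap (ρ : Equiv.Perm ι) {t : ι → Equiv.Perm A} (ht : ∀ i, t i 0 = 0)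
    (f : (ι → A) → R) (x : ι → A) :
    raise R (fun y => f (wordMap ρ t y)) x = raise R f (wordMap ρ t x) := by
  simp only [raise, LinearMap.coe_mk, AddHom.coe_mk]
  rw [← Equiv.sum_comp ρ]
  refine Finset.sum_congr rfl fun i _ => ?_
  rw [← update_wordMap, ht, wordMap, nz_perm (ht i)]

variable [Fintype A]

/-- The operator on functions of words that sums over all ways to replace a zero by a nonzero
letter; it lowers the weight of the support by one. -/
def lower : ((ι → A) → R) →ₗ[R] ((ι → A) → R) where
  toFun f x := ∑ i, (1 - (nz (x i) : R)) * ∑ c, (nz c : R) * f (Function.update x i c)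
  map_add' f g := by
    ext x
    simp [mul_add, Finset.sum_add_distrib]
  map_smul' c f := by
    ext x
    simp only [Pi.smul_apply, smul_eq_mul, RingHom.id_apply, Finset.mul_sum]
    exact Finset.sum_congr rfl fun i _ => Finset.sum_congr rfl fun _ _ => by ring

lemma lower_slice (D : PairData ι) {ε : A → ℤ} (h0 : ε 0 = 0) (hsum : ∑ c, ε c = 0) (w : ℕ) :
    lower R (fun x => (D.slice ε (w + 1) x : R)) =
      (((∑ c : A, nz c) * (Fintype.card ι - w - D.k) : ℤ) : R) •
        fun x => (D.slice ε w x : R) := by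
  ext x
  have h := congrArg (Int.cast (R := R)) (D.sum_slice_update_ne_zero h0 hsum w x)
  simpa [lower] using h

lemma lower_comp_wordMap (ρ : Equiv.Perm ι) {t : ι → Equiv.Perm A} (ht : ∀ i, t i 0 = 0)
    (f : (ι → A) → R) (x : ι → A) :
    lower R (fun y => f (wordMap ρ t y)) x = lower R f (wordMap ρ t x) := by
  simp only [lower, LinearMap.coe_mk, AddHom.coe_mk]
  rw [← Equiv.sum_comp ρ]
  refine Finset.sum_congr rfl fun i _ => ?_
  rw [wordMap, nz_perm (ht i)]
  congr 1
  refine Eq.trans ?_ (Equiv.sum_comp (t i) fun c =>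
    (nz c : R) * f (Function.update (wordMap ρ t x) i c))
  refine Finset.sum_congr rfl fun c _ => ?_
  rw [update_wordMap, nz_perm (ht i)]

end Operators

end Words

/-! ### Two-row tableaux and their vectors -/

section TwoRow

/-- Functions whose fibres have the same sizes differ by a permutation of the domain. -/
lemma exists_perm_comp_eq {α β : Type*} [Fintype α] [DecidableEq β] {f g : α → β}
    (h : ∀ b, (Finset.univ.filter fun a => f a = b).card =
      (Finset.univ.filter fun a => g a = b).card) : ∃ π : Equiv.Perm α, g = f ∘ π := by
  have e : ∀ b, Nonempty ({a // g a = b} ≃ {a // f a = b}) := fun b => by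
    rw [← Fintype.card_eq, Fintype.card_subtype, Fintype.card_subtype, h b]
  exact ⟨Equiv.ofFiberEquiv fun b => (e b).some, funext fun a =>
    (Equiv.ofFiberEquiv_map (fun b => (e b).some) a).symm⟩

namespace YoungDiagram

variable (μ : YoungDiagram)

/-- The cell in the first row above the `j`-th cell of the second row. -/
def upperCell (j : Fin (μ.rowLen 1)) : μ.cells :=
  ⟨(0, j), μ.up_left_mem zero_le_one le_rfl (YoungDiagram.mem_iff_lt_rowLen.2 j.2)⟩

/-- The `j`-th cell of the second row. -/
def lowerCell (j : Fin (μ.rowLen 1)) : μ.cells :=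
  ⟨(1, j), YoungDiagram.mem_iff_lt_rowLen.2 j.2⟩

lemma upperCell_injective : Function.Injective μ.upperCell := fun i j h => by
  simpa [upperCell, Fin.ext_iff] using h

lemma lowerCell_injective : Function.Injective μ.lowerCell := fun i j h => by
  simpa [lowerCell, Fin.ext_iff] using h

lemma upperCell_ne_lowerCell (i j : Fin (μ.rowLen 1)) : μ.upperCell i ≠ μ.lowerCell j := fun h => by
  simp [upperCell, lowerCell] at h

variable {μ}

lemma exists_eq_lowerCell {y : μ.cells} (hy : y.1.1 = 1) : ∃ j, y = μ.lowerCell j :=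
  ⟨⟨y.1.2, YoungDiagram.mem_iff_lt_rowLen.1 (by
    have := (YoungDiagram.mem_cells _).1 y.2
    rwa [← hy])⟩, Subtype.ext (Prod.ext hy rfl)⟩

lemma mem_iff_of_le_one (h : ∀ y : μ.cells, y.1.1 ≤ 1) (c : ℕ × ℕ) :
    c ∈ μ.cells ↔ c.1 = 0 ∧ c.2 < μ.rowLen 0 ∨ c.1 = 1 ∧ c.2 < μ.rowLen 1 := by
  obtain ⟨i, j⟩ := c
  constructor
  · intro hc
    have h1 := h ⟨_, hc⟩
    simp only at h1
    have h2 := YoungDiagram.mem_iff_lt_rowLen.1 ((YoungDiagram.mem_cells _).1 hc)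
    interval_cases i
    · exact Or.inl ⟨rfl, h2⟩
    · exact Or.inr ⟨rfl, h2⟩
  · rintro (⟨rfl, h⟩ | ⟨rfl, h⟩)
    · exact YoungDiagram.mem_iff_lt_rowLen.2 h
    · exact YoungDiagram.mem_iff_lt_rowLen.2 h

lemma card_eq_of_le_one (h : ∀ y : μ.cells, y.1.1 ≤ 1) :
    μ.card = μ.rowLen 0 + μ.rowLen 1 := by
  have h1 : μ.cells = ({0} ×ˢ Finset.range (μ.rowLen 0)) ∪ ({1} ×ˢ Finset.range (μ.rowLen 1)) := by
    ext ⟨i, j⟩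
    rw [mem_iff_of_le_one h]
    simp only [Finset.mem_union, Finset.mem_product, Finset.mem_singleton, Finset.mem_range]
  rw [YoungDiagram.card, h1, Finset.card_union_of_disjoint]
  · simp
  · rw [Finset.disjoint_left]
    simp

/-- A diagram with at most two rows is determined by its size and the length of the second row. -/
lemma eq_of_le_one {ν : YoungDiagram} (hμ : ∀ y : μ.cells, y.1.1 ≤ 1)
    (hν : ∀ y : ν.cells, y.1.1 ≤ 1) (hcard : μ.card = ν.card) (h1 : μ.rowLen 1 = ν.rowLen 1) :
    μ = ν := by
  rw [card_eq_of_le_one hμ, card_eq_of_le_one hν] at hcard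
  have h0 : μ.rowLen 0 = ν.rowLen 0 := by omega
  ext c
  rw [mem_iff_of_le_one hμ, mem_iff_of_le_one hν, h0, h1]

/-- The diagram with rows of lengths `n - k` and `k`. -/
def twoRow (n k : ℕ) (h : 2 * k ≤ n) : YoungDiagram where
  cells := ({0} ×ˢ Finset.range (n - k)) ∪ ({1} ×ˢ Finset.range k)
  isLowerSet := by
    rintro ⟨i, j⟩ ⟨i', j'⟩ hle hm
    have h1 : i' ≤ i := hle.1
    have h2 : j' ≤ j := hle.2
    simp at hm ⊢
    omega

lemma mem_twoRow {n k : ℕ} {h : 2 * k ≤ n} {i j : ℕ} :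
    (i, j) ∈ twoRow n k h ↔ i = 0 ∧ j < n - k ∨ i = 1 ∧ j < k := by
  rw [← YoungDiagram.mem_cells]
  simp only [twoRow, Finset.mem_union, Finset.mem_product, Finset.mem_singleton, Finset.mem_range]

lemma twoRow_le_one {n k : ℕ} {h : 2 * k ≤ n} (y : (twoRow n k h).cells) : y.1.1 ≤ 1 := by
  obtain ⟨⟨i, j⟩, hy⟩ := y
  have h1 := mem_twoRow.1 ((YoungDiagram.mem_cells _).1 hy)
  simp only
  omega

lemma rowLen_twoRow {n k : ℕ} {h : 2 * k ≤ n} : (twoRow n k h).rowLen 1 = k := by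
  refine eq_of_forall_lt_iff fun j => ?_
  rw [← YoungDiagram.mem_iff_lt_rowLen, mem_twoRow]
  omega

lemma card_twoRow {n k : ℕ} {h : 2 * k ≤ n} : (twoRow n k h).card = n := by
  have h0 : (twoRow n k h).rowLen 0 = n - k := by
    refine eq_of_forall_lt_iff fun j => ?_
    rw [← YoungDiagram.mem_iff_lt_rowLen, mem_twoRow]
    omega
  rw [card_eq_of_le_one twoRow_le_one, h0, rowLen_twoRow]
  omega

end YoungDiagram

open YoungDiagram

variable {μ : YoungDiagram}

/-- The number of entries `1` (the larger letter) of a tableau with entries in `Fin 2`. -/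
def numOnes (τ : μ.cells → Fin 2) : ℕ := (Finset.univ.filter fun y => τ y = 1).card

lemma numOnes_add_card_zeros (τ : μ.cells → Fin 2) :
    numOnes τ + (Finset.univ.filter fun y => τ y = 0).card = μ.card := by
  have h := Finset.card_filter_add_card_filter_not (s := (Finset.univ : Finset μ.cells))
    (fun y => τ y = 1)
  have h2 : (Finset.univ.filter fun y => ¬ τ y = 1) = Finset.univ.filter fun y => τ y = 0 := by
    refine Finset.filter_congr fun y _ => ?_
    omega
  rw [h2, Finset.card_univ, Fintype.card_coe] at h
  exact h

lemma numOnes_comp_perm (τ : μ.cells → Fin 2) (π : Equiv.Perm μ.cells) :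
    numOnes (τ ∘ π) = numOnes τ := by
  rw [numOnes, numOnes, Finset.card_filter, Finset.card_filter]
  exact Equiv.sum_comp π fun y => if τ y = 1 then 1 else 0

namespace IsSemistandard

variable {τ τ' : μ.cells → Fin 2}

lemma le_one (hτ : IsSemistandard τ) (y : μ.cells) : y.1.1 ≤ 1 := by
  by_contra! hy
  obtain ⟨⟨i, j⟩, hm⟩ := y
  simp only at hy
  have hm' := (YoungDiagram.mem_cells _).1 hm
  have h0 : (0, j) ∈ μ.cells := μ.up_left_mem (Nat.zero_le i) le_rfl hm'
  have h1 : (1, j) ∈ μ.cells := μ.up_left_mem (by omega) le_rfl hm'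
  have h2 := hτ.2 ⟨_, h0⟩ ⟨_, h1⟩ rfl zero_lt_one
  have h3 := hτ.2 ⟨_, h1⟩ ⟨_, hm⟩ rfl hy
  omega

lemma upperCell_eq (hτ : IsSemistandard τ) (j : Fin (μ.rowLen 1)) : τ (μ.upperCell j) = 0 := by
  have := hτ.2 (μ.upperCell j) (μ.lowerCell j) rfl zero_lt_one
  omega

lemma lowerCell_eq (hτ : IsSemistandard τ) (j : Fin (μ.rowLen 1)) : τ (μ.lowerCell j) = 1 := by
  have := hτ.2 (μ.upperCell j) (μ.lowerCell j) rfl zero_lt_one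
  omega

lemma rowLen_le_numOnes (hτ : IsSemistandard τ) : μ.rowLen 1 ≤ numOnes τ := by
  have h := Finset.card_le_card_of_injOn (s := (Finset.univ : Finset (Fin (μ.rowLen 1))))
    (t := Finset.univ.filter fun y => τ y = 1) μ.lowerCell
    (fun j _ => by simp [hτ.lowerCell_eq j]) μ.lowerCell_injective.injOn
  rwa [Finset.card_univ, Fintype.card_fin] at h

lemma numOnes_add_rowLen_le (hτ : IsSemistandard τ) : numOnes τ + μ.rowLen 1 ≤ μ.card := by
  have h := Finset.card_le_card_of_injOn (s := (Finset.univ : Finset (Fin (μ.rowLen 1))))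
    (t := Finset.univ.filter fun y => τ y = 0) μ.upperCell
    (fun j _ => by simp [hτ.upperCell_eq j]) μ.upperCell_injective.injOn
  have h2 := numOnes_add_card_zeros τ
  simp only [Finset.card_univ, Fintype.card_fin] at h
  omega

/-- A semistandard tableau with two letters is determined by its content. -/
lemma eq_of_numOnes_eq (hτ : IsSemistandard τ) (hτ' : IsSemistandard τ')
    (h : numOnes τ = numOnes τ') : τ = τ' := by
  have key : ∀ {τ τ' : μ.cells → Fin 2}, IsSemistandard τ → IsSemistandard τ' →
      numOnes τ = numOnes τ' → ∀ y, τ y = 1 → τ' y = 1 := by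
    intro τ τ' hτ hτ' h y hy
    by_contra hy'
    have hrow : ∀ z : μ.cells, z.1.1 ≠ 0 → τ z = 1 ∧ τ' z = 1 := fun z hz => by
      obtain ⟨j, rfl⟩ := exists_eq_lowerCell (le_antisymm (hτ.le_one z) (Nat.pos_of_ne_zero hz))
      exact ⟨hτ.lowerCell_eq j, hτ'.lowerCell_eq j⟩
    have hy0 : y.1.1 = 0 := by
      by_contra h0
      exact hy' (hrow y h0).2
    -- If `τ y = 1` and `τ' y = 0`, then all ones of `τ'` are ones of `τ`, in the first row because
    -- they lie to the right of `y`.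
    refine (Finset.card_lt_card (s := Finset.univ.filter fun y => τ' y = 1)
      (t := Finset.univ.filter fun y => τ y = 1)
      (Finset.ssubset_iff_of_subset (fun z hz => ?_) |>.2 ⟨y, by simp [hy], by simp [hy']⟩)).ne
      h.symm
    simp only [Finset.mem_filter, Finset.mem_univ, true_and] at hz ⊢
    by_cases hz0 : z.1.1 = 0
    · rcases le_total z.1.2 y.1.2 with hle | hle
      · have := hτ'.1 z y (by rw [hz0, hy0]) hle
        omega
      · have := hτ.1 y z (by rw [hz0, hy0]) hle
        omega
    · exact (hrow z hz0).1
  funext y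
  have h1 := key hτ hτ' h y
  have h2 := key hτ' hτ h.symm y
  omega

/-- Row equivalence with a semistandard tableau with two letters. -/
lemma rowEquiv_iff (hτ : IsSemistandard τ) (σ : μ.cells → Fin 2) :
    RowEquiv τ σ ↔ (∀ j, σ (μ.lowerCell j) = 1) ∧ numOnes σ = numOnes τ := by
  constructor
  · rintro ⟨π, hπ, rfl⟩
    refine ⟨fun j => ?_, numOnes_comp_perm τ π⟩
    obtain ⟨j', hj'⟩ := exists_eq_lowerCell (y := π (μ.lowerCell j)) (hπ (μ.lowerCell j))
    rw [Function.comp_apply, hj', hτ.lowerCell_eq]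
  · rintro ⟨h1, h2⟩
    have hrow : ∀ y : μ.cells, y.1.1 = 1 → τ y = 1 ∧ σ y = 1 := fun y hy => by
      obtain ⟨j, rfl⟩ := exists_eq_lowerCell hy
      exact ⟨hτ.lowerCell_eq j, h1 j⟩
    -- Both tableaux are constant on the second row, so their contents agree in each row.
    have hsplit : ∀ (ρ : μ.cells → Fin 2) (b : Fin 2),
        (Finset.univ.filter fun y => ρ y = b).card =
        (Finset.univ.filter fun y : μ.cells => (y.1.1, ρ y) = (0, b)).card +
        (Finset.univ.filter fun y : μ.cells => (y.1.1, ρ y) = (1, b)).card := by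
      intro ρ b
      rw [← Finset.card_union_of_disjoint]
      · congr 1
        ext y
        have := hτ.le_one y
        simp only [Finset.mem_filter, Finset.mem_univ, true_and, Finset.mem_union, Prod.mk.injEq]
        omega
      · rw [Finset.disjoint_left]
        intro y
        simp only [Finset.mem_filter, Finset.mem_univ, true_and, Prod.mk.injEq]
        omega
    have hlow : ∀ b, (Finset.univ.filter fun y : μ.cells => (y.1.1, τ y) = (1, b)) =
        Finset.univ.filter fun y : μ.cells => (y.1.1, σ y) = (1, b) := by
      intro b
      refine Finset.filter_congr fun y _ => ?_
      simp only [Prod.mk.injEq]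
      refine and_congr_right fun hy => ?_
      rw [(hrow y hy).1, (hrow y hy).2]
    have hall : ∀ b, (Finset.univ.filter fun y => τ y = b).card =
        (Finset.univ.filter fun y => σ y = b).card := by
      intro b
      have h3 := numOnes_add_card_zeros τ
      have h4 := numOnes_add_card_zeros σ
      unfold numOnes at h2 h3 h4
      fin_cases b
      · change (Finset.univ.filter fun y => τ y = 0).card =
          (Finset.univ.filter fun y => σ y = 0).card
        omega
      · exact h2.symm
    obtain ⟨π, hπ⟩ := exists_perm_comp_eq (f := fun y : μ.cells => (y.1.1, τ y))
      (g := fun y => (y.1.1, σ y)) (by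
        rintro ⟨i, b⟩
        have h3 := hall b
        rw [hsplit τ b, hsplit σ b, hlow b] at h3
        by_cases h0 : i = 0
        · subst h0
          omega
        · by_cases h1 : i = 1
          · subst h1
            rw [hlow b]
          · rw [Finset.filter_false_of_mem, Finset.filter_false_of_mem]
            all_goals
              intro y _ hy
              have := hτ.le_one y
              simp only [Prod.mk.injEq] at hy
              omega)
    refine ⟨π, fun y => ?_, funext fun y => ?_⟩
    · exact (congrArg Prod.fst (congrFun hπ y)).symm
    · exact congrArg Prod.snd (congrFun hπ y)

end IsSemistandard

/-- There are semistandard tableaux with two letters of all admissible contents. -/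
lemma exists_ssTableau_twoRow {n k w : ℕ} (h : 2 * k ≤ n) (h1 : k ≤ w) (h2 : w + k ≤ n) :
    ∃ τ : SSTableau (twoRow n k h) 2, numOnes τ.1 = w := by
  refine ⟨⟨fun y => if y.1.1 = 0 ∧ y.1.2 < n - w then 0 else 1, ?_, ?_⟩, ?_⟩
  · rintro ⟨⟨i, j⟩, hy⟩ ⟨⟨i', j'⟩, hz⟩ hi hj
    simp only at hi hj ⊢
    subst hi
    split_ifs with h3 h4
    · exact le_rfl
    · exact zero_le_one
    · exact absurd ⟨by omega, by omega⟩ h3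
    · exact le_rfl
  · rintro ⟨⟨i, j⟩, hy⟩ ⟨⟨i', j'⟩, hz⟩ hj hi
    simp only at hi hj ⊢
    have h3 := mem_twoRow.1 ((YoungDiagram.mem_cells _).1 hy)
    have h4 := mem_twoRow.1 ((YoungDiagram.mem_cells _).1 hz)
    rw [if_pos (by omega), if_neg (by omega)]
    exact zero_lt_one
  · have h3 := numOnes_add_card_zeros (μ := twoRow n k h)
      fun y => if y.1.1 = 0 ∧ y.1.2 < n - w then 0 else 1
    rw [card_twoRow] at h3
    have h4 : (Finset.univ.filter fun y : (twoRow n k h).cells =>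
        (if y.1.1 = 0 ∧ y.1.2 < n - w then (0 : Fin 2) else 1) = 0).card = n - w := by
      rw [← Finset.card_map (Function.Embedding.subtype _)]
      have h5 : (Finset.univ.filter fun y : (twoRow n k h).cells =>
          (if y.1.1 = 0 ∧ y.1.2 < n - w then (0 : Fin 2) else 1) = 0).map
          (Function.Embedding.subtype _) = {0} ×ˢ Finset.range (n - w) := by
        ext ⟨i, j⟩
        simp only [Finset.mem_map, Finset.mem_filter, Finset.mem_univ, true_and,
          Function.Embedding.subtype_apply, Subtype.exists, exists_and_right, exists_eq_right,
          Finset.mem_product, Finset.mem_singleton, Finset.mem_range, YoungDiagram.mem_cells,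
          mem_twoRow]
        by_cases hij : i = 0 ∧ j < n - w
        · simp only [hij, and_self, if_true, true_and, exists_prop, and_true]
          exact iff_true_intro (Or.inl (by omega))
        · simp [hij]
      rw [h5]
      simp
    rw [h4] at h3
    simp only
    omega

end TwoRow

/-! ### The vectors of tableaux with at most two letters -/

section TableauVec

open YoungDiagram

variable {μ : YoungDiagram}

lemma prod_lowerCell_swap (X : μ.cells → Fin 2) (j : Fin (μ.rowLen 1)) :
    ∏ i, (nz (X (Equiv.swap (μ.upperCell j) (μ.lowerCell j) (μ.lowerCell i))) -
      nz (X (Equiv.swap (μ.upperCell j) (μ.lowerCell j) (μ.upperCell i)))) =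
    -∏ i, (nz (X (μ.lowerCell i)) - nz (X (μ.upperCell i))) := by
  rw [← Finset.mul_prod_erase _ _ (Finset.mem_univ j),
    ← Finset.mul_prod_erase _ _ (Finset.mem_univ j), ← neg_mul, Equiv.swap_apply_left,
    Equiv.swap_apply_right, neg_sub]
  congr 1
  refine Finset.prod_congr rfl fun i hi => ?_
  have hij := Finset.ne_of_mem_erase hi
  rw [Equiv.swap_apply_of_ne_of_ne (μ.upperCell_ne_lowerCell _ _).symm
      (fun h => hij (μ.lowerCell_injective h)),
    Equiv.swap_apply_of_ne_of_ne (fun h => hij (μ.upperCell_injective h))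
      (μ.upperCell_ne_lowerCell _ _)]

lemma swap_mem_colStabilizer (j : Fin (μ.rowLen 1)) :
    Equiv.swap (μ.upperCell j) (μ.lowerCell j) ∈ colStabilizer μ := by
  intro y
  rcases eq_or_ne y (μ.upperCell j) with rfl | h1
  · rw [Equiv.swap_apply_left]
    rfl
  rcases eq_or_ne y (μ.lowerCell j) with rfl | h2
  · rw [Equiv.swap_apply_right]
    rfl
  rw [Equiv.swap_apply_of_ne_of_ne h1 h2]

open Classical in
/-- The alternating sum over the column stabilizer, over those `c` for which `X ∘ c` is constant
`1` on the second row. -/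
noncomputable def colSum (X : μ.cells → Fin 2) : ℤ :=
  ∑ c : Equiv.Perm μ.cells with c ∈ colStabilizer μ,
    (Equiv.Perm.sign c : ℤ) * if ∀ j, X (c (μ.lowerCell j)) = 1 then 1 else 0

lemma colSum_swap (X : μ.cells → Fin 2) (j : Fin (μ.rowLen 1)) :
    colSum (X ∘ Equiv.swap (μ.upperCell j) (μ.lowerCell j)) = -colSum X := by
  classical
  rw [colSum, colSum, Finset.sum_filter, Finset.sum_filter, ← Finset.sum_neg_distrib,
    ← Equiv.sum_comp (Equiv.mulLeft (Equiv.swap (μ.upperCell j) (μ.lowerCell j)))]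
  refine Finset.sum_congr rfl fun c _ => ?_
  have h1 : Equiv.mulLeft (Equiv.swap (μ.upperCell j) (μ.lowerCell j)) c ∈ colStabilizer μ ↔
      c ∈ colStabilizer μ := Subgroup.mul_mem_cancel_left _ (swap_mem_colStabilizer j)
  have h2 : ∀ y, (X ∘ Equiv.swap (μ.upperCell j) (μ.lowerCell j))
      (Equiv.mulLeft (Equiv.swap (μ.upperCell j) (μ.lowerCell j)) c y) = X (c y) := by simp
  rw [if_congr h1 rfl rfl]
  simp only [h2]
  rw [Equiv.coe_mulLeft, Equiv.Perm.sign_mul,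
    Equiv.Perm.sign_swap (μ.upperCell_ne_lowerCell j j)]
  split_ifs <;> simp

/-- The column stabilizer of a two-row diagram is generated by the exchanges in the columns of
length two; hence the alternating sum is a product of differences. -/
lemma colSum_eq_prod (hμ : ∀ y : μ.cells, y.1.1 ≤ 1) (X : μ.cells → Fin 2) :
    colSum X = ∏ j, (nz (X (μ.lowerCell j)) - nz (X (μ.upperCell j))) := by
  classical
  induction hN : (Finset.univ.filter fun j => X (μ.lowerCell j) = 0).card
    using Nat.strong_induction_on generalizing X with
  | _ N ih =>
  subst hN
  by_cases heq : ∃ j, X (μ.lowerCell j) = X (μ.upperCell j)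
  · -- Both sides change sign under an exchange that leaves `X` unchanged.
    obtain ⟨j, hj⟩ := heq
    have hX : X ∘ Equiv.swap (μ.upperCell j) (μ.lowerCell j) = X := by
      funext y
      rw [Function.comp_apply, Equiv.swap_apply_def]
      split_ifs with h1 h2
      · rw [h1, hj]
      · rw [h2, hj]
      · rfl
    have h1 := colSum_swap X j
    rw [hX] at h1
    rw [Finset.prod_eq_zero (Finset.mem_univ j) (by rw [hj, sub_self])]
    omega
  push Not at heq
  by_cases h0 : ∃ j, X (μ.lowerCell j) = 0
  · obtain ⟨j, hj⟩ := h0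
    have hj' : X (μ.upperCell j) = 1 := by
      have := heq j
      omega
    have hlt : (Finset.univ.filter fun i =>
        (X ∘ Equiv.swap (μ.upperCell j) (μ.lowerCell j)) (μ.lowerCell i) = 0).card <
        (Finset.univ.filter fun i => X (μ.lowerCell i) = 0).card := by
      refine Finset.card_lt_card ((Finset.ssubset_iff_of_subset fun i hi => ?_).2
        ⟨j, by simp [hj], by simp [hj']⟩)
      simp only [Finset.mem_filter, Finset.mem_univ, true_and, Function.comp_apply] at hi ⊢
      rcases eq_or_ne i j with rfl | hij
      · exact hj
      · rwa [Equiv.swap_apply_of_ne_of_ne (μ.upperCell_ne_lowerCell _ _).symm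
          (fun h => hij (μ.lowerCell_injective h))] at hi
    have h1 := ih _ hlt _ rfl
    rw [colSum_swap] at h1
    simp only [Function.comp_apply] at h1
    rw [prod_lowerCell_swap] at h1
    exact neg_injective h1
  · -- Only the identity contributes.
    push Not at h0
    have hlow : ∀ j, X (μ.lowerCell j) = 1 := fun j => by
      have := h0 j
      omega
    have hup : ∀ j, X (μ.upperCell j) = 0 := fun j => by
      have := heq j
      have := hlow j
      omega
    simp only [hlow, hup, nz_zero, nz_of_ne_zero (one_ne_zero' (Fin 2)), sub_zero,
      Finset.prod_const_one]
    rw [colSum, Finset.sum_eq_single 1]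
    · simp [hlow]
    · intro c hc hc1
      rw [if_neg, mul_zero]
      intro h
      refine hc1 (Equiv.ext fun y => ?_)
      have hcol : ∀ y, (c y).1.2 = y.1.2 := (Finset.mem_filter.1 hc).2
      have hB : ∀ j, c (μ.lowerCell j) = μ.lowerCell j := by
        intro j
        have h1 : (c (μ.lowerCell j)).1.2 = j := hcol _
        have h2 := hμ (c (μ.lowerCell j))
        by_contra hne
        have h3 : c (μ.lowerCell j) = μ.upperCell j := by
          refine Subtype.ext (Prod.ext ?_ h1)
          by_contra h0
          exact hne (Subtype.ext (Prod.ext (le_antisymm h2 (Nat.pos_of_ne_zero h0)) h1))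
        have h4 := h j
        rw [h3, hup] at h4
        exact zero_ne_one h4
      by_cases hy : y.1.1 = 1
      · obtain ⟨j, rfl⟩ := exists_eq_lowerCell hy
        exact hB j
      · have hy' : (c y).1.1 ≠ 1 := fun h1 => by
          obtain ⟨j, hj⟩ := exists_eq_lowerCell h1
          rw [← hB j, c.apply_eq_iff_eq] at hj
          exact hy (by rw [hj]; rfl)
        have h1 := hμ y
        have h2 := hμ (c y)
        exact Subtype.ext (Prod.ext (by rw [Equiv.Perm.one_apply]; omega) (hcol y))
    · intro h
      exact absurd (Finset.mem_filter.2 ⟨Finset.mem_univ _, one_mem _⟩) h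

variable {𝕜 : Type*} [RCLike 𝕜]

/-- The vector of a semistandard tableau with two letters, for the identity matrix. -/
lemma tableauVec_matA₁ {τ : μ.cells → Fin 2} (hτ : IsSemistandard τ) (x : Fin μ.card → Fin 2) :
    tableauVec (matA₁ 𝕜) τ x = ((if numOnes (x ∘ rowReading μ) = numOnes τ then
      ∏ j, (nz (x (rowReading μ (μ.lowerCell j))) - nz (x (rowReading μ (μ.upperCell j))))
      else 0 : ℤ) : 𝕜) := by
  classical
  have hA : ∀ a b : Fin 2, matA₁ 𝕜 a b = if a = b then 1 else 0 := by
    intro a b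
    fin_cases a <;> fin_cases b <;> simp [matA₁]
  have hprod : ∀ (c : Equiv.Perm μ.cells) (τ' : μ.cells → Fin 2),
      ∏ y, matA₁ 𝕜 (x (rowReading μ y)) (τ' (c y)) =
        if (x ∘ rowReading μ) ∘ ⇑c⁻¹ = τ' then 1 else 0 := by
    intro c τ'
    simp only [hA]
    rw [Finset.prod_ite_zero, Finset.prod_const_one]
    have hiff : (∀ y ∈ Finset.univ, x (rowReading μ y) = τ' (c y)) ↔
        (x ∘ rowReading μ) ∘ ⇑c⁻¹ = τ' := by
      constructor
      · intro h
        funext y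
        simpa using h (c⁻¹ y) (Finset.mem_univ _)
      · rintro rfl y _
        simp
    by_cases h : (x ∘ rowReading μ) ∘ ⇑c⁻¹ = τ'
    · rw [if_pos h, if_pos (hiff.2 h)]
    · rw [if_neg h, if_neg fun h' => h (hiff.1 h')]
  have hcol := colSum_eq_prod hτ.le_one (x ∘ rowReading μ)
  simp only [Function.comp_apply] at hcol
  rw [tableauVec, ← hcol, colSum, Finset.sum_comm]
  have hinner : ∀ c : Equiv.Perm μ.cells,
      ∑ τ' : μ.cells → Fin 2 with RowEquiv τ τ', ((Equiv.Perm.sign c : ℤ) : 𝕜) *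
        ∏ y, matA₁ 𝕜 (x (rowReading μ y)) (τ' (c y)) =
      ((Equiv.Perm.sign c⁻¹ : ℤ) : 𝕜) *
        if (∀ j, (x ∘ rowReading μ) (c⁻¹ (μ.lowerCell j)) = 1) ∧
          numOnes (x ∘ rowReading μ) = numOnes τ then 1 else 0 := by
    intro c
    simp only [hprod]
    rw [← Finset.mul_sum, Finset.sum_ite_eq, Equiv.Perm.sign_inv]
    congr 1
    refine if_congr ?_ rfl rfl
    rw [Finset.mem_filter, hτ.rowEquiv_iff, numOnes_comp_perm]
    simp
  rw [Finset.sum_congr rfl fun c _ => hinner c, Finset.sum_filter, Finset.sum_filter,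
    ← Equiv.sum_comp (Equiv.inv (Equiv.Perm μ.cells))]
  simp only [Equiv.inv_apply, inv_inv, Subgroup.inv_mem_iff, Function.comp_apply]
  split_ifs with h
  · push_cast
    refine Finset.sum_congr rfl fun c _ => ?_
    simp only [h, and_true]
  · simp [h]

/-- The map identifying the nonzero letters of `[3]`. -/
def collapse (c : Fin 3) : Fin 2 := if c = 0 then 0 else 1

lemma nz_collapse (c : Fin 3) : nz (collapse c) = nz c := by
  fin_cases c <;> rfl

lemma tableauVec_matA₂ (τ : μ.cells → Fin 2) (x : Fin μ.card → Fin 3) :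
    tableauVec (matA₂ 𝕜) τ x = tableauVec (matA₁ 𝕜) τ (collapse ∘ x) := by
  have h : ∀ a b, matA₂ 𝕜 a b = matA₁ 𝕜 (collapse a) b := by
    intro a b
    fin_cases a <;> fin_cases b <;> simp [matA₁, matA₂, collapse]
  simp only [tableauVec, h, Function.comp_apply]

/-- The letter weights of `A₃`. -/
def signLetter : Fin 3 → ℤ := ![0, 1, -1]

lemma IsSemistandard.row_eq_zero {τ : μ.cells → Fin 1} (hτ : IsSemistandard τ) (y : μ.cells) :
    y.1.1 = 0 := by
  by_contra hy
  have h0 : (0, y.1.2) ∈ μ.cells :=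
    μ.up_left_mem (Nat.zero_le _) le_rfl ((YoungDiagram.mem_cells _).1 y.2)
  have := hτ.2 ⟨_, h0⟩ y rfl (Nat.pos_of_ne_zero hy)
  omega

lemma tableauVec_matA₃ {τ : μ.cells → Fin 1} (hτ : IsSemistandard τ) (x : Fin μ.card → Fin 3) :
    tableauVec (matA₃ 𝕜) τ x = ((∏ i, signLetter (x i) : ℤ) : 𝕜) := by
  classical
  have hA : ∀ a b, matA₃ 𝕜 a b = (signLetter a : 𝕜) := by
    intro a b
    fin_cases a <;> fin_cases b <;> simp [matA₃, signLetter]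
  have hc : ∀ c ∈ colStabilizer μ, c = 1 := fun c hc => Equiv.ext fun y =>
    Subtype.ext (Prod.ext ((hτ.row_eq_zero _).trans (hτ.row_eq_zero _).symm) (hc y))
  have h1 : (Finset.univ.filter fun c : Equiv.Perm μ.cells => c ∈ colStabilizer μ) = {1} := by
    ext c
    simp only [Finset.mem_filter, Finset.mem_univ, true_and, Finset.mem_singleton]
    exact ⟨hc c, fun h => h ▸ one_mem _⟩
  have h2 : (Finset.univ.filter fun τ' : μ.cells → Fin 1 => RowEquiv τ τ') = {τ} := by
    ext τ'
    simp only [Finset.mem_filter, Finset.mem_univ, true_and, Finset.mem_singleton]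
    exact ⟨fun _ => Subsingleton.elim _ _, fun h => ⟨1, one_mem _, h⟩⟩
  rw [tableauVec, h1, h2, Finset.sum_singleton, Finset.sum_singleton]
  simp only [hA, Equiv.Perm.sign_one, Units.val_one, Int.cast_one, one_mul]
  rw [Equiv.prod_comp (rowReading μ) fun i => (signLetter (x i) : 𝕜)]
  push_cast
  rfl

end TableauVec

/-! ### The stabilizer of the zero word -/

section Stabilizer

variable {n₂ n₃ : ℕ}

lemma hammingDist_update {ι A : Type*} [Fintype ι] [DecidableEq ι] [DecidableEq A]
    (x y : ι → A) (i : ι) (c : A) :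
    (hammingDist x (Function.update y i c) : ℤ) =
      hammingDist x y - (if x i = y i then 0 else 1) + if x i = c then 0 else 1 := by
  have h : ∀ z : ι → A, (hammingDist x z : ℤ) = ∑ j, if x j = z j then 0 else 1 := fun z => by
    simp [hammingDist, Finset.card_filter, ite_not]
  rw [h, h, ← Finset.add_sum_erase _ _ (Finset.mem_univ i),
    ← Finset.add_sum_erase (a := i) _ (fun j => if x j = y j then (0 : ℤ) else 1)
      (Finset.mem_univ i),
    Finset.sum_congr rfl fun j hj => by
      rw [Function.update_of_ne (Finset.ne_of_mem_erase hj)]]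
  rw [Function.update_self]
  ring

/-- The nonzero letters: the letter `1` at a binary coordinate, or the letter `a + 1` at a ternary
coordinate. -/
abbrev Letter (n₂ n₃ : ℕ) : Type := Fin n₂ ⊕ Fin n₃ × Fin 2

/-- The word `v` contains the letter `l`. -/
def HasLetter (v : Word n₂ n₃) : Letter n₂ n₃ → Prop :=
  Sum.elim (fun i => v.1 i = 1) fun p => v.2 p.1 = p.2.succ

/-- The word of weight one with the given letter. -/
def unitWord : Letter n₂ n₃ → Word n₂ n₃ :=
  Sum.elim (fun i => (Pi.single i 1, 0)) fun p => (0, Pi.single p.1 p.2.succ)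

lemma Word.ext_hasLetter {v w : Word n₂ n₃} (h : ∀ l, HasLetter v l ↔ HasLetter w l) : v = w := by
  refine Prod.ext (funext fun i => ?_) (funext fun j => ?_)
  · have : v.1 i = 1 ↔ w.1 i = 1 := h (Sum.inl i)
    omega
  · have h0 : v.2 j = 1 ↔ w.2 j = 1 := h (Sum.inr (j, 0))
    have h1 : v.2 j = 2 ↔ w.2 j = 2 := h (Sum.inr (j, 1))
    omega

lemma hasLetter_iff (v : Word n₂ n₃) (l : Letter n₂ n₃) :
    HasLetter v l ↔ wordDist v (unitWord l) < wordDist v 0 := by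
  rcases l with i | ⟨j, a⟩
  · have h := hammingDist_update v.1 0 i 1
    have h1 : wordDist v (unitWord (Sum.inl i)) =
      hammingDist v.1 (Function.update 0 i 1) + hammingDist v.2 0 := rfl
    have h2 : wordDist v 0 = hammingDist v.1 0 + hammingDist v.2 0 := rfl
    have h3 : HasLetter v (Sum.inl i) ↔ v.1 i = 1 := Iff.rfl
    have h4 : v.1 i = 0 ∨ v.1 i = 1 := by omega
    rw [h1, h2, h3]
    rcases h4 with h4 | h4 <;> simp [h4] at h ⊢ <;> omega
  · have h := hammingDist_update v.2 0 j a.succ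
    have h1 : wordDist v (unitWord (Sum.inr (j, a))) =
      hammingDist v.1 0 + hammingDist v.2 (Function.update 0 j a.succ) := rfl
    have h2 : wordDist v 0 = hammingDist v.1 0 + hammingDist v.2 0 := rfl
    have h3 : HasLetter v (Sum.inr (j, a)) ↔ v.2 j = a.succ := Iff.rfl
    rw [h1, h2, h3]
    by_cases h4 : v.2 j = a.succ
    · simp [h4] at h ⊢
      omega
    · simp only [h4, if_false, false_iff] at h ⊢
      split_ifs at h <;> omega

lemma exists_eq_single_of_hammingNorm_eq_one {ι A : Type*} [Fintype ι] [DecidableEq ι] [Zero A]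
    [DecidableEq A] {x : ι → A} (h : hammingNorm x = 1) : ∃ i, x i ≠ 0 ∧ x = Pi.single i (x i) := by
  obtain ⟨i, hi⟩ := Finset.card_eq_one.1 h
  have hmem : ∀ j, x j ≠ 0 ↔ j = i := fun j => by
    have := Finset.ext_iff.1 hi j
    simpa using this
  refine ⟨i, (hmem i).2 rfl, funext fun j => ?_⟩
  by_cases hj : j = i
  · subst hj
    rw [Pi.single_eq_same]
  · rw [Pi.single_eq_of_ne hj]
    by_contra h0
    exact hj ((hmem j).1 h0)

lemma exists_eq_unitWord {v : Word n₂ n₃} (h : wordDist v 0 = 1) : ∃ l, v = unitWord l := by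
  have h1 : hammingNorm v.1 + hammingNorm v.2 = 1 := by
    rw [← hammingDist_zero_right, ← hammingDist_zero_right]
    exact h
  rcases Nat.eq_zero_or_pos (hammingNorm v.1) with h0 | h0
  · obtain ⟨j, hj, hv⟩ := exists_eq_single_of_hammingNorm_eq_one (x := v.2) (by omega)
    obtain ⟨a, ha⟩ := Fin.exists_succ_eq.2 hj
    refine ⟨Sum.inr (j, a), Prod.ext (hammingNorm_eq_zero.1 h0) ?_⟩
    rw [hv, ← ha]
    rfl
  · obtain ⟨i, hi, hv⟩ := exists_eq_single_of_hammingNorm_eq_one (x := v.1) (by omega)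
    have h1 : v.1 i = 1 := by omega
    refine ⟨Sum.inl i, Prod.ext ?_ (hammingNorm_eq_zero.1 (by omega))⟩
    rw [hv, h1]
    rfl

lemma wordDist_unitWord (l : Letter n₂ n₃) : wordDist (unitWord l) 0 = 1 := by
  rcases l with i | ⟨j, a⟩
  · have h := hammingNorm_update (0 : Fin n₂ → Fin 2) i 1
    have h1 : wordDist (unitWord (Sum.inl i : Letter n₂ n₃)) 0 =
      hammingDist (Function.update 0 i 1 : Fin n₂ → Fin 2) 0 +
        hammingDist (0 : Fin n₃ → Fin 3) 0 := rfl
    rw [h1, hammingDist_zero_right, hammingDist_self]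
    simp [nz] at h
    omega
  · have h := hammingNorm_update (0 : Fin n₃ → Fin 3) j a.succ
    have h1 : wordDist (unitWord (Sum.inr (j, a) : Letter n₂ n₃)) 0 =
      hammingDist (0 : Fin n₂ → Fin 2) 0 +
        hammingDist (Function.update 0 j a.succ : Fin n₃ → Fin 3) 0 := rfl
    rw [h1, hammingDist_self, hammingDist_zero_right]
    simp [nz, Fin.succ_ne_zero] at h
    omega

lemma hasLetter_unitWord (l m : Letter n₂ n₃) : HasLetter (unitWord l) m ↔ m = l := by
  rcases l with i | ⟨j, a⟩ <;> rcases m with i' | ⟨j', a'⟩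
  · change (Pi.single i 1 : Fin n₂ → Fin 2) i' = 1 ↔ _
    rw [Pi.single_apply]
    simp
  · change (0 : Fin 3) = _ ↔ _
    simp [(Fin.succ_ne_zero _).symm]
  · change (0 : Fin 2) = _ ↔ _
    simp
  · change (Pi.single j a.succ : Fin n₃ → Fin 3) j' = _ ↔ _
    rw [Pi.single_apply]
    split_ifs with h
    · simp [h, eq_comm]
    · simp [h, (Fin.succ_ne_zero _).symm]

/-- Two letters fail to occur together in a word exactly if they are distinct letters at the same
ternary coordinate. -/
lemma not_exists_hasLetter_iff (l m : Letter n₂ n₃) :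
    (¬ ∃ v, HasLetter v l ∧ HasLetter v m) ↔
      ∃ j a b, a ≠ b ∧ l = Sum.inr (j, a) ∧ m = Sum.inr (j, b) := by
  constructor
  · intro h
    rcases l with i | ⟨j, a⟩ <;> rcases m with i' | ⟨j', a'⟩
    · exact absurd ⟨(fun _ => 1, 0), rfl, rfl⟩ h
    · exact absurd ⟨(fun _ => 1, fun _ => a'.succ), rfl, rfl⟩ h
    · exact absurd ⟨(fun _ => 1, fun _ => a.succ), rfl, rfl⟩ h
    · by_cases hj : j = j'
      · subst hj
        refine ⟨j, a, a', ?_, rfl, rfl⟩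
        rintro rfl
        exact h ⟨(fun _ => 1, fun _ => a.succ), rfl, rfl⟩
      · exact absurd ⟨(fun _ => 1, fun i => if i = j then a.succ else a'.succ), if_pos rfl,
          if_neg (Ne.symm hj)⟩ h
  · rintro ⟨j, a, b, hab, rfl, rfl⟩ ⟨v, h1, h2⟩
    have h3 : v.2 j = a.succ := h1
    have h4 : v.2 j = b.succ := h2
    exact hab (Fin.succ_injective _ (h3.symm.trans h4))

lemma letterMap_mul (s t : Equiv.Perm (Fin 2)) (c : Fin 3) :
    letterMap (s * t) c = letterMap s (letterMap t c) := by
  refine Fin.cases ?_ (fun i => ?_) c <;> rfl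

lemma letterMap_one (c : Fin 3) : letterMap 1 c = c := by
  refine Fin.cases ?_ (fun i => ?_) c <;> rfl

/-- The permutation of the letters of `[3]` that fixes `0` and permutes the nonzero letters by
`s`. -/
def letterPerm (s : Equiv.Perm (Fin 2)) : Equiv.Perm (Fin 3) where
  toFun := letterMap s
  invFun := letterMap s⁻¹
  left_inv c := by rw [← letterMap_mul, inv_mul_cancel, letterMap_one]
  right_inv c := by rw [← letterMap_mul, mul_inv_cancel, letterMap_one]

lemma letterPerm_zero (s : Equiv.Perm (Fin 2)) : letterPerm s 0 = 0 := rfl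

/-- The group `S_{n₂} × (S₂^{n₃} ⋊ S_{n₃})`. -/
abbrev CoordGroup (n₂ n₃ : ℕ) : Type :=
  Equiv.Perm (Fin n₂) × ((Fin n₃ → Equiv.Perm (Fin 2)) ⋊[mulAutArrow] Equiv.Perm (Fin n₃))

/-- The permutation of the words given by permutations of the coordinates and of the nonzero
ternary letters. -/
def coordAct (p : CoordGroup n₂ n₃) (v : Word n₂ n₃) : Word n₂ n₃ :=
  (fun i => v.1 (p.1⁻¹ i), fun j => letterMap (p.2.left j) (v.2 (p.2.right⁻¹ j)))

lemma coordAct_mul (p q : CoordGroup n₂ n₃) (v : Word n₂ n₃) :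
    coordAct (p * q) v = coordAct p (coordAct q v) := by
  refine Prod.ext (funext fun i => ?_) (funext fun j => ?_)
  · simp [coordAct]
  · simp only [coordAct, Prod.snd_mul, SemidirectProduct.mul_left, SemidirectProduct.mul_right,
      Pi.mul_apply, letterMap_mul, mul_inv_rev, Equiv.Perm.mul_apply]
    rfl

lemma coordAct_one (v : Word n₂ n₃) : coordAct 1 v = v := by
  refine Prod.ext (funext fun i => ?_) (funext fun j => ?_)
  · simp [coordAct]
  · simp [coordAct, letterMap_one]

lemma coordAct_zero (p : CoordGroup n₂ n₃) : coordAct p 0 = 0 := rfl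

lemma coordAct_fst (p : CoordGroup n₂ n₃) (v : Word n₂ n₃) :
    (coordAct p v).1 = wordMap p.1⁻¹ (fun _ => 1) v.1 := rfl

lemma coordAct_snd (p : CoordGroup n₂ n₃) (v : Word n₂ n₃) :
    (coordAct p v).2 = wordMap p.2.right⁻¹ (fun j => letterPerm (p.2.left j)) v.2 := rfl

lemma hammingDist_wordMap {ι A : Type*} [Fintype ι] [DecidableEq A] (ρ : Equiv.Perm ι)
    (t : ι → Equiv.Perm A) (x y : ι → A) :
    hammingDist (wordMap ρ t x) (wordMap ρ t y) = hammingDist x y := by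
  have h : ∀ x y : ι → A, hammingDist x y = ∑ j, if x j ≠ y j then 1 else 0 := fun x y =>
    Finset.card_filter _ _
  rw [h, h, ← Equiv.sum_comp ρ fun j => if x j ≠ y j then 1 else 0]
  simp [wordMap]

lemma wordDist_coordAct (p : CoordGroup n₂ n₃) (v w : Word n₂ n₃) :
    wordDist (coordAct p v) (coordAct p w) = wordDist v w := by
  simp only [wordDist, coordAct_fst, coordAct_snd, hammingDist_wordMap]

variable (n₂ n₃) in
/-- The homomorphism from `S_{n₂} × (S₂^{n₃} ⋊ S_{n₃})` to the stabilizer of the zero word. -/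
def coordHom : CoordGroup n₂ n₃ →* codeStabilizer {(0 : Word n₂ n₃)} where
  toFun p := ⟨⟨⟨coordAct p, coordAct p⁻¹,
      fun v => by rw [← coordAct_mul, inv_mul_cancel, coordAct_one],
      fun v => by rw [← coordAct_mul, mul_inv_cancel, coordAct_one]⟩,
      wordDist_coordAct p⟩, by
    rw [MulAction.mem_stabilizer_iff, Finset.smul_finset_singleton]
    exact congrArg _ (coordAct_zero p)⟩
  map_one' := Subtype.ext (Subtype.ext (Equiv.ext coordAct_one))
  map_mul' p q := Subtype.ext (Subtype.ext (Equiv.ext (coordAct_mul p q)))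

lemma coordHom_smul (p : CoordGroup n₂ n₃) (v : Word n₂ n₃) :
    coordHom n₂ n₃ p • v = coordAct p v := rfl

lemma coordHom_injective : Function.Injective (coordHom n₂ n₃) := by
  rw [injective_iff_map_eq_one]
  intro p hp
  have h : ∀ v, coordAct p v = v := fun v => by rw [← coordHom_smul, hp, one_smul]
  have h1 : p.1 = 1 := by
    rw [← inv_eq_one]
    ext i
    have := congrFun (congrArg Prod.fst (h (Pi.single i 1, 0))) i
    simp only [coordAct, Pi.single_eq_same, Pi.single_apply] at this
    split_ifs at this with hi
    · rw [hi]
      rfl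
    · exact absurd this zero_ne_one
  have h2 : p.2.right = 1 := by
    rw [← inv_eq_one]
    ext i
    have := congrFun (congrArg Prod.snd (h (0, Pi.single i 1))) i
    simp only [coordAct, Pi.single_eq_same, Pi.single_apply] at this
    split_ifs at this with hi
    · rw [hi]
      rfl
    · exact absurd this (by decide : ¬ (0 : Fin 3) = 1)
  have h3 : p.2.left = 1 := by
    funext j
    ext a
    have := congrFun (congrArg Prod.snd (h (0, fun _ => a.succ))) j
    have h4 : (p.2.left j a).succ = a.succ := this
    rw [Fin.succ_injective _ h4]
    rfl
  exact Prod.ext h1 (SemidirectProduct.ext h3 h2)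

/-- An isometry fixing the zero word permutes the words of weight one, hence the letters. Letters
at the same ternary coordinate stay together, as they exclude each other. -/
lemma coordHom_surjective : Function.Surjective (coordHom n₂ n₃) := by
  intro g
  have hdist : ∀ v w : Word n₂ n₃, wordDist (g • v) (g • w) = wordDist v w := g.1.2
  have hzero : g • (0 : Word n₂ n₃) = 0 := by
    have h1 := g.2
    rw [MulAction.mem_stabilizer_iff, Finset.smul_finset_singleton] at h1
    exact Finset.singleton_injective h1
  have hdist0 : ∀ v : Word n₂ n₃, wordDist (g • v) 0 = wordDist v 0 := fun v => by
    rw [← hdist v 0, hzero]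
  have hunit : ∀ l : Letter n₂ n₃, ∃ m : Letter n₂ n₃, g • unitWord l = unitWord m := fun l =>
    exists_eq_unitWord (by rw [hdist0, wordDist_unitWord])
  choose f hf using hunit
  have hfinj : Function.Injective f := by
    intro l m hlm
    have h1 : unitWord l = unitWord m := smul_left_cancel g (by rw [hf, hf, hlm])
    have h2 := (hasLetter_unitWord l l).2 rfl
    rw [h1, hasLetter_unitWord] at h2
    exact h2
  let π : Equiv.Perm (Letter n₂ n₃) := Equiv.ofBijective f (Finite.injective_iff_bijective.1 hfinj)
  have hπ : ∀ v l, HasLetter (g • v) (π l) ↔ HasLetter v l := by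
    intro v l
    rw [hasLetter_iff, hasLetter_iff, hdist0]
    change wordDist (g • v) (unitWord (f l)) < _ ↔ _
    rw [← hf, hdist]
  have hcomp : ∀ l m, (∃ v, HasLetter v (π l) ∧ HasLetter v (π m)) ↔
      ∃ v, HasLetter v l ∧ HasLetter v m := by
    intro l m
    constructor
    · rintro ⟨v, h1, h2⟩
      refine ⟨g⁻¹ • v, ?_, ?_⟩
      · rwa [← hπ, smul_inv_smul]
      · rwa [← hπ, smul_inv_smul]
    · rintro ⟨v, h1, h2⟩
      exact ⟨g • v, (hπ _ _).2 h1, (hπ _ _).2 h2⟩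
  have hinl : Set.MapsTo π (Set.range Sum.inl) (Set.range Sum.inl) := by
    rintro _ ⟨i, rfl⟩
    rcases hm : π (Sum.inl i) with i' | ⟨j, a⟩
    · exact ⟨i', rfl⟩
    · obtain ⟨m, hm'⟩ := π.surjective (Sum.inr (j, a + 1))
      have h1 := (not_exists_hasLetter_iff (π (Sum.inl i)) (π m)).2
        ⟨j, a, a + 1, by simp, hm, hm'⟩
      rw [hcomp, not_exists_hasLetter_iff] at h1
      obtain ⟨_, _, _, _, h2, _⟩ := h1
      exact absurd h2 Sum.inl_ne_inr
  obtain ⟨⟨σ, θ⟩, hσθ⟩ := Equiv.Perm.mem_sumCongrHom_range_of_perm_mapsTo_inl hinl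
  have hσ : ∀ i, π (Sum.inl i) = Sum.inl (σ i) := fun i => by rw [← hσθ]; rfl
  have hθ : ∀ q, π (Sum.inr q) = Sum.inr (θ q) := fun q => by rw [← hσθ]; rfl
  have hθfst : ∀ j a b, (θ (j, a)).1 = (θ (j, b)).1 := by
    intro j a b
    by_cases hab : a = b
    · rw [hab]
    have h1 := (not_exists_hasLetter_iff (n₂ := n₂) (Sum.inr (j, a)) (Sum.inr (j, b))).2
      ⟨j, a, b, hab, rfl, rfl⟩
    rw [← hcomp, not_exists_hasLetter_iff, hθ, hθ] at h1
    obtain ⟨j', a', b', -, h2, h3⟩ := h1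
    rw [Sum.inr_injective h2, Sum.inr_injective h3]
  let σ₃ : Equiv.Perm (Fin n₃) := Equiv.ofBijective (fun j => (θ (j, 0)).1)
    (Finite.surjective_iff_bijective.1 fun j => by
      obtain ⟨⟨j', a⟩, h⟩ := θ.surjective (j, 0)
      refine ⟨j', ?_⟩
      rw [hθfst j' 0 a, h])
  let s : Fin n₃ → Equiv.Perm (Fin 2) := fun j => Equiv.ofBijective (fun a => (θ (j, a)).2)
    (Finite.injective_iff_bijective.1 fun a b hab => by
      have := θ.injective (Prod.ext (hθfst j a b) hab)
      exact congrArg Prod.snd this)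
  have hθ' : ∀ j a, θ (j, a) = (σ₃ j, s j a) := fun j a => Prod.ext (hθfst j a 0) rfl
  refine ⟨(σ, ⟨fun j => s (σ₃⁻¹ j), σ₃⟩), ?_⟩
  refine Subtype.ext (Subtype.ext (Equiv.ext fun v => ?_))
  change coordAct _ v = g • v
  refine Word.ext_hasLetter fun l => ?_
  obtain ⟨m, rfl⟩ := π.surjective l
  rw [hπ]
  rcases m with i | ⟨j, a⟩
  · rw [hσ]
    change v.1 (σ⁻¹ (σ i)) = 1 ↔ v.1 i = 1
    rw [Equiv.Perm.inv_eq_iff_eq.2 rfl]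
  · rw [hθ, hθ']
    change letterPerm (s (σ₃⁻¹ (σ₃ j))) (v.2 (σ₃⁻¹ (σ₃ j))) = letterPerm (s j) a.succ ↔
      v.2 j = a.succ
    rw [Equiv.Perm.inv_eq_iff_eq.2 rfl, (letterPerm (s j)).apply_eq_iff_eq]

/-- The stabilizer of the zero word is `S_{n₂} × (S₂^{n₃} ⋊ S_{n₃})`. -/
noncomputable def stabilizerEquiv (n₂ n₃ : ℕ) :
    codeStabilizer {(0 : Word n₂ n₃)} ≃* CoordGroup n₂ n₃ :=
  (MulEquiv.ofBijective (coordHom n₂ n₃) ⟨coordHom_injective, coordHom_surjective⟩).symm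

lemma smul_eq_coordAct (g : codeStabilizer {(0 : Word n₂ n₃)}) (v : Word n₂ n₃) :
    g • v = coordAct (stabilizerEquiv n₂ n₃ g) v := by
  rw [← coordHom_smul]
  exact congrArg (· • v) ((stabilizerEquiv n₂ n₃).symm_apply_apply g).symm

end Stabilizer

/-! ### Orbits of pairs of words -/

section PairOrbits

variable {ι A : Type*} [Zero A] [DecidableEq A]

/-- The type of a pair of letters: `(0, 0)`, `(0, *)`, `(*, 0)`, equal and nonzero, or distinct and
nonzero. -/
def pairType (a b : A) : Fin 5 :=
  if a = 0 then if b = 0 then 0 else 1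
  else if b = 0 then 2 else if a = b then 3 else 4

variable [Fintype ι]

/-- The number of coordinates at which two words have letters of the given type. -/
def typeCount (v w : ι → A) (t : Fin 5) : ℕ :=
  (Finset.univ.filter fun i => pairType (v i) (w i) = t).card

lemma sum_typeCount (v w : ι → A) : typeCount v w 0 + typeCount v w 1 + typeCount v w 2 +
    typeCount v w 3 + typeCount v w 4 = Fintype.card ι := by
  have h := Finset.card_eq_sum_card_fiberwise (s := (Finset.univ : Finset ι)) (t := Finset.univ)
    (f := fun i => pairType (v i) (w i)) (fun i _ => Finset.mem_coe.2 (Finset.mem_univ _))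
  rw [Fin.sum_univ_five] at h
  exact h.symm

lemma hammingNorm_fst_eq (v w : ι → A) :
    hammingNorm v = typeCount v w 2 + typeCount v w 3 + typeCount v w 4 := by
  simp only [hammingNorm, typeCount, Finset.card_filter, ← Finset.sum_add_distrib]
  refine Finset.sum_congr rfl fun i _ => ?_
  unfold pairType
  split_ifs <;> simp_all

lemma hammingNorm_snd_eq (v w : ι → A) :
    hammingNorm w = typeCount v w 1 + typeCount v w 3 + typeCount v w 4 := by
  simp only [hammingNorm, typeCount, Finset.card_filter, ← Finset.sum_add_distrib]
  refine Finset.sum_congr rfl fun i _ => ?_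
  unfold pairType
  split_ifs <;> simp_all

/-- The weights of two words, the number of coordinates with distinct nonzero letters and the
minimum of the numbers of coordinates with letters `(0, 0)` and with equal nonzero letters determine
the counts of all types. -/
lemma exists_perm_pairType {v w v' w' : ι → A} (hv : hammingNorm v = hammingNorm v')
    (hw : hammingNorm w = hammingNorm w') (h4 : typeCount v w 4 = typeCount v' w' 4)
    (hmin : min (typeCount v w 0) (typeCount v w 3) =
      min (typeCount v' w' 0) (typeCount v' w' 3)) :
    ∃ ρ : Equiv.Perm ι, ∀ i, pairType (v' i) (w' i) = pairType (v (ρ i)) (w (ρ i)) := by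
  have h1 := sum_typeCount v w
  have h2 := sum_typeCount v' w'
  rw [hammingNorm_fst_eq v w, hammingNorm_fst_eq v' w'] at hv
  rw [hammingNorm_snd_eq v w, hammingNorm_snd_eq v' w'] at hw
  obtain ⟨ρ, hρ⟩ := exists_perm_comp_eq (f := fun i => pairType (v i) (w i))
    (g := fun i => pairType (v' i) (w' i)) (by
      intro t
      change typeCount v w t = typeCount v' w' t
      fin_cases t
      · change typeCount v w 0 = typeCount v' w' 0
        omega
      · change typeCount v w 1 = typeCount v' w' 1
        omega
      · change typeCount v w 2 = typeCount v' w' 2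
        omega
      · change typeCount v w 3 = typeCount v' w' 3
        omega
      · exact h4)
  exact ⟨ρ, fun i => congrFun hρ i⟩

end PairOrbits

section WordOrbits

variable {n₂ n₃ : ℕ}

lemma eq_of_pairType_eq : ∀ a b a' b' : Fin 2, pairType a b = pairType a' b' → a = a' ∧ b = b' := by
  decide

lemma exists_letterMap_of_pairType_eq : ∀ a b a' b' : Fin 3, pairType a' b' = pairType a b →
    ∃ s : Equiv.Perm (Fin 2), letterMap s a = a' ∧ letterMap s b = b' := by
  decide

/-- Pairs of words with the same invariants are in the same orbit of the stabilizer of the zero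
word. -/
lemma exists_smul_pair_eq {v w v' w' : Word n₂ n₃}
    (hv₁ : hammingNorm v.1 = hammingNorm v'.1) (hw₁ : hammingNorm w.1 = hammingNorm w'.1)
    (hv₂ : hammingNorm v.2 = hammingNorm v'.2) (hw₂ : hammingNorm w.2 = hammingNorm w'.2)
    (h1 : min (typeCount v.1 w.1 0) (typeCount v.1 w.1 3) =
      min (typeCount v'.1 w'.1 0) (typeCount v'.1 w'.1 3))
    (h2 : min (typeCount v.2 w.2 0) (typeCount v.2 w.2 3) =
      min (typeCount v'.2 w'.2 0) (typeCount v'.2 w'.2 3))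
    (h4 : typeCount v.2 w.2 4 = typeCount v'.2 w'.2 4) :
    ∃ g : codeStabilizer {(0 : Word n₂ n₃)}, g • v = v' ∧ g • w = w' := by
  have hbin : ∀ v w : Fin n₂ → Fin 2, typeCount v w 4 = 0 := by
    intro v w
    have : ∀ a b : Fin 2, pairType a b ≠ 4 := by decide
    simp [typeCount, this]
  obtain ⟨ρ, hρ⟩ := exists_perm_pairType hv₁ hw₁ (by rw [hbin, hbin]) h1
  obtain ⟨θ, hθ⟩ := exists_perm_pairType hv₂ hw₂ h4 h2
  choose s hs using fun j => exists_letterMap_of_pairType_eq _ _ _ _ (hθ j)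
  refine ⟨coordHom n₂ n₃ (ρ⁻¹, ⟨s, θ⁻¹⟩), ?_, ?_⟩ <;>
    rw [coordHom_smul, coordAct] <;>
    refine Prod.ext (funext fun i => ?_) (funext fun j => ?_) <;>
    simp only [inv_inv]
  · exact (eq_of_pairType_eq _ _ _ _ (hρ i)).1.symm
  · exact (hs j).1
  · exact (eq_of_pairType_eq _ _ _ _ (hρ i)).2.symm
  · exact (hs j).2

end WordOrbits

/-! ### The tableau vectors as functions of words -/

section ShapeVectors

open YoungDiagram

variable {n₂ n₃ : ℕ}

/-- The pairs of coordinates formed by the columns of length two of a diagram. -/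
noncomputable def tableauPairs (μ : YoungDiagram) {ι : Type*} (f : Fin μ.card ↪ ι) (L : Finset ι)
    (hL : ∀ i, f i ∉ L) : PairData ι where
  k := μ.rowLen 1
  a j := f (rowReading μ (μ.upperCell j))
  b j := f (rowReading μ (μ.lowerCell j))
  L := L
  a_inj := f.injective.comp ((rowReading μ).injective.comp μ.upperCell_injective)
  b_inj := f.injective.comp ((rowReading μ).injective.comp μ.lowerCell_injective)
  a_ne_b i j h := μ.upperCell_ne_lowerCell i j ((rowReading μ).injective (f.injective h))
  a_notMem _ := hL _
  b_notMem _ := hL _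

namespace ShapeTriple

variable (s : ShapeTriple n₂ n₃)

/-- The pairs of binary coordinates of a triple of shapes. -/
noncomputable def binPairs : PairData (Fin n₂) :=
  tableauPairs s.μ₁ (finCongr s.card₁).toEmbedding ∅ fun _ => Finset.notMem_empty _

/-- The pairs of ternary coordinates of a triple of shapes, and the set of the last `l₃` ternary
coordinates. -/
noncomputable def ternPairs : PairData (Fin n₃) :=
  tableauPairs s.μ₂ ((Fin.castAddEmb s.μ₃.card).trans (finCongr s.card₂₃).toEmbedding)
    (Finset.univ.map ((Fin.natAddEmb s.μ₂.card).trans (finCongr s.card₂₃).toEmbedding)) (by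
      intro i h
      obtain ⟨j, -, hj⟩ := Finset.mem_map.1 h
      have h1 := congrArg Fin.val hj
      simp at h1
      have := i.2
      omega)

lemma card_ternPairs_L : s.ternPairs.L.card = s.μ₃.card := by
  simp [ternPairs, tableauPairs]

lemma numOnes_comp_rowReading {μ : YoungDiagram} (x : Fin μ.card → Fin 2) :
    numOnes (x ∘ rowReading μ) = hammingNorm x := by
  rw [numOnes, hammingNorm, Finset.card_filter, Finset.card_filter,
    ← Equiv.sum_comp (rowReading μ)]
  refine Finset.sum_congr rfl fun y _ => if_congr ?_ rfl rfl
  rw [Function.comp_apply]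
  omega

variable {s} in
lemma weight_eq (τ : s.W) :
    s.weight τ = numOnes τ.1.1 + (numOnes τ.2.1.1 + s.μ₃.card : ℕ) := by
  have h1 := numOnes_add_card_zeros τ.1.1
  have h2 := numOnes_add_card_zeros τ.2.1.1
  have h3 := s.card₁
  have h4 := s.card₂₃
  unfold weight
  push_cast
  omega

variable (𝕜 : Type*) [RCLike 𝕜]

/-- The vector `u_τ` depends on the tableaux only through the restriction to words of given binary
and ternary weight. -/
lemma vec_eq (τ : s.W) (v : Word n₂ n₃) :
    s.vec 𝕜 τ v = ((s.binPairs.slice 0 (numOnes τ.1.1) v.1 *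
      s.ternPairs.slice signLetter (numOnes τ.2.1.1 + s.μ₃.card) v.2 : ℤ) : 𝕜) := by
  obtain ⟨μ₁, μ₂, μ₃, rfl, rfl⟩ := s
  rw [vec, tableauVec_matA₂, tableauVec_matA₁ τ.1.2, tableauVec_matA₁ τ.2.1.2,
    tableauVec_matA₃ τ.2.2.2, ← Int.cast_mul, ← Int.cast_mul, mul_assoc]
  congr 2
  · rw [numOnes_comp_rowReading, PairData.slice]
    refine if_congr Iff.rfl ?_ rfl
    simp only [PairData.poly, PairData.diff, binPairs, tableauPairs, Finset.prod_empty, mul_one]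
    rfl
  · rw [numOnes_comp_rowReading, PairData.slice, ite_mul, zero_mul]
    have hL : ∏ i ∈ (ternPairs ⟨μ₁, μ₂, μ₃, rfl, rfl⟩).L, signLetter (v.2 i) =
        ∏ i, signLetter (v.2 (Fin.natAdd μ₂.card i)) := by
      simp [ternPairs, tableauPairs]
    have hpoly : (ternPairs ⟨μ₁, μ₂, μ₃, rfl, rfl⟩).poly signLetter v.2 =
        (∏ j, (nz (v.2 (Fin.castAdd _ (rowReading μ₂ (μ₂.lowerCell j)))) -
          nz (v.2 (Fin.castAdd _ (rowReading μ₂ (μ₂.upperCell j)))))) *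
        ∏ i, signLetter (v.2 (Fin.natAdd μ₂.card i)) := by
      rw [PairData.poly, hL]
      rfl
    rw [hpoly]
    simp only [Function.comp_apply, nz_collapse, Fin.cast_refl, id_eq]
    by_cases h0 : ∏ i, signLetter (v.2 (Fin.natAdd μ₂.card i)) = 0
    · rw [h0, mul_zero, ite_self, ite_self]
    · refine if_congr ?_ rfl rfl
      rw [← ne_eq, Finset.prod_ne_zero_iff] at h0
      have h1 : (hammingNorm v.2 : ℤ) = hammingNorm (fun i => collapse (v.2 (Fin.castAdd _ i))) +
          μ₃.card := by
        rw [hammingNorm_eq_sum_nz, hammingNorm_eq_sum_nz, Fin.sum_univ_add]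
        simp only [nz_collapse]
        congr 1
        rw [Finset.sum_congr rfl fun i hi => nz_of_ne_zero fun h => h0 i hi (by rw [h]; rfl)]
        simp
      have h2 : hammingNorm (collapse ∘ fun i => v.2 (Fin.castAdd μ₃.card i)) =
        hammingNorm (fun i => collapse (v.2 (Fin.castAdd _ i))) := rfl
      rw [h2]
      omega

end ShapeTriple

end ShapeVectors

/-! ### Equivariant maps changing the content -/

section Shift

variable {𝕜 : Type*} [RCLike 𝕜]

/-- The operator on functions on a product applying an operator in the first variable. -/
def onFst {R X Y : Type*} [CommRing R] (Φ : (X → R) →ₗ[R] (X → R)) :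
    (X × Y → R) →ₗ[R] (X × Y → R) where
  toFun f v := Φ (fun x => f (x, v.2)) v.1
  map_add' f g := funext fun v =>
    congrFun (Φ.map_add (fun x => f (x, v.2)) fun x => g (x, v.2)) v.1
  map_smul' c f := funext fun v => congrFun (Φ.map_smul c fun x => f (x, v.2)) v.1

/-- The operator on functions on a product applying an operator in the second variable. -/
def onSnd {R X Y : Type*} [CommRing R] (Φ : (Y → R) →ₗ[R] (Y → R)) :
    (X × Y → R) →ₗ[R] (X × Y → R) where
  toFun f v := Φ (fun y => f (v.1, y)) v.2
  map_add' f g := funext fun v =>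
    congrFun (Φ.map_add (fun y => f (v.1, y)) fun y => g (v.1, y)) v.2
  map_smul' c f := funext fun v => congrFun (Φ.map_smul c fun y => f (v.1, y)) v.2

variable {n₂ n₃ : ℕ}

lemma onFst_mem_equivariantEnd {Φ : ((Fin n₂ → Fin 2) → 𝕜) →ₗ[𝕜] ((Fin n₂ → Fin 2) → 𝕜)}
    (hΦ : ∀ (ρ : Equiv.Perm (Fin n₂)) f x,
      Φ (fun y => f (wordMap ρ (fun _ => 1) y)) x = Φ f (wordMap ρ (fun _ => 1) x)) :
    onFst Φ ∈ equivariantEnd 𝕜 (codeStabilizer {(0 : Word n₂ n₃)}) (Word n₂ n₃) := by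
  intro g f
  funext v
  rw [permRep_apply, smul_eq_coordAct]
  have h : ∀ w, permRep 𝕜 (codeStabilizer {(0 : Word n₂ n₃)}) (Word n₂ n₃) g f w =
      f (coordAct (stabilizerEquiv n₂ n₃ g⁻¹) w) := fun w => by
    rw [permRep_apply, smul_eq_coordAct]
  simp only [onFst, LinearMap.coe_mk, AddHom.coe_mk, h]
  exact hΦ _ (fun x => f (x, (coordAct (stabilizerEquiv n₂ n₃ g⁻¹) v).2)) v.1

lemma onSnd_mem_equivariantEnd {Φ : ((Fin n₃ → Fin 3) → 𝕜) →ₗ[𝕜] ((Fin n₃ → Fin 3) → 𝕜)}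
    (hΦ : ∀ (ρ : Equiv.Perm (Fin n₃)) (t : Fin n₃ → Equiv.Perm (Fin 2)) f x,
      Φ (fun y => f (wordMap ρ (fun j => letterPerm (t j)) y)) x =
        Φ f (wordMap ρ (fun j => letterPerm (t j)) x)) :
    onSnd Φ ∈ equivariantEnd 𝕜 (codeStabilizer {(0 : Word n₂ n₃)}) (Word n₂ n₃) := by
  intro g f
  funext v
  rw [permRep_apply, smul_eq_coordAct]
  have h : ∀ w, permRep 𝕜 (codeStabilizer {(0 : Word n₂ n₃)}) (Word n₂ n₃) g f w =
      f (coordAct (stabilizerEquiv n₂ n₃ g⁻¹) w) := fun w => by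
    rw [permRep_apply, smul_eq_coordAct]
  simp only [onSnd, LinearMap.coe_mk, AddHom.coe_mk, h]
  exact hΦ _ _ (fun y => f ((coordAct (stabilizerEquiv n₂ n₃ g⁻¹) v).1, y)) v.2

/-- Some equivariant endomorphism takes `f` to a nonzero multiple of `h`. -/
def MapsToMultiple {G X : Type*} [Group G] [MulAction G X] (f h : X → 𝕜) : Prop :=
  ∃ Φ ∈ equivariantEnd 𝕜 G X, ∃ c : 𝕜, c ≠ 0 ∧ Φ f = c • h

lemma MapsToMultiple.refl {G X : Type*} [Group G] [MulAction G X] (f : X → 𝕜) :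
    MapsToMultiple (G := G) f f :=
  ⟨LinearMap.id, fun _ _ => rfl, 1, one_ne_zero, (one_smul _ _).symm⟩

lemma MapsToMultiple.trans {G X : Type*} [Group G] [MulAction G X] {f h k : X → 𝕜}
    (h1 : MapsToMultiple (G := G) f h) (h2 : MapsToMultiple (G := G) h k) :
    MapsToMultiple (G := G) f k := by
  obtain ⟨Φ, hΦ, c, hc, hf⟩ := h1
  obtain ⟨Ψ, hΨ, d, hd, hh⟩ := h2
  refine ⟨Ψ ∘ₗ Φ, fun g f => by simp only [LinearMap.comp_apply, hΦ g, hΨ g], c * d,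
    mul_ne_zero hc hd, ?_⟩
  rw [LinearMap.comp_apply, hf, map_smul, hh, smul_smul]

/-- The product of a slice in the binary and a slice in the ternary part. -/
def sliceProd (𝕜 : Type*) [RCLike 𝕜] (D : PairData (Fin n₂)) (E : PairData (Fin n₃)) (w w' : ℕ)
    (v : Word n₂ n₃) : 𝕜 :=
  ((D.slice 0 w v.1 * E.slice signLetter w' v.2 : ℤ) : 𝕜)

lemma onFst_sliceProd {Φ : ((Fin n₂ → Fin 2) → 𝕜) →ₗ[𝕜] ((Fin n₂ → Fin 2) → 𝕜)}
    {D : PairData (Fin n₂)} {w u : ℕ} {c : 𝕜}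
    (h : Φ (fun x => (D.slice 0 w x : 𝕜)) = c • fun x => (D.slice 0 u x : 𝕜))
    (E : PairData (Fin n₃)) (w' : ℕ) :
    onFst Φ (sliceProd 𝕜 D E w w') = c • sliceProd 𝕜 D E u w' := by
  funext v
  have h1 : (fun x => sliceProd 𝕜 D E w w' (x, v.2)) =
      (E.slice signLetter w' v.2 : 𝕜) • fun x => (D.slice 0 w x : 𝕜) := by
    funext x
    simp [sliceProd, mul_comm]
  simp only [onFst, LinearMap.coe_mk, AddHom.coe_mk, h1, map_smul, h]
  simp only [Pi.smul_apply, smul_eq_mul, sliceProd]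
  push_cast
  ring

lemma onSnd_sliceProd {Φ : ((Fin n₃ → Fin 3) → 𝕜) →ₗ[𝕜] ((Fin n₃ → Fin 3) → 𝕜)}
    {E : PairData (Fin n₃)} {w' u : ℕ} {c : 𝕜}
    (h : Φ (fun x => (E.slice signLetter w' x : 𝕜)) = c • fun x => (E.slice signLetter u x : 𝕜))
    (D : PairData (Fin n₂)) (w : ℕ) :
    onSnd Φ (sliceProd 𝕜 D E w w') = c • sliceProd 𝕜 D E w u := by
  funext v
  have h1 : (fun x => sliceProd 𝕜 D E w w' (v.1, x)) =
      (D.slice 0 w v.1 : 𝕜) • fun x => (E.slice signLetter w' x : 𝕜) := by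
    funext x
    simp [sliceProd]
  simp only [onSnd, LinearMap.coe_mk, AddHom.coe_mk, h1, map_smul, h]
  simp only [Pi.smul_apply, smul_eq_mul, sliceProd]
  push_cast
  ring

/-- A reflexive and transitive relation on an interval that relates neighbours in both directions
relates everything. -/
lemma rel_of_rel_succ {P : ℕ → ℕ → Prop} (hrefl : ∀ a, P a a)
    (htrans : ∀ a b c, P a b → P b c → P a c) {lo hi : ℕ}
    (hup : ∀ a, lo ≤ a → a + 1 ≤ hi → P a (a + 1)) (hdown : ∀ a, lo ≤ a → a + 1 ≤ hi → P (a + 1) a)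
    {a b : ℕ} (ha : lo ≤ a) (ha' : a ≤ hi) (hb : lo ≤ b) (hb' : b ≤ hi) : P a b := by
  have key : ∀ a b, lo ≤ a → a ≤ b → b ≤ hi → P a b ∧ P b a := by
    intro a b ha hab
    induction b, hab using Nat.le_induction with
    | base => exact fun _ => ⟨hrefl a, hrefl a⟩
    | succ b hab ih =>
      intro hb
      obtain ⟨h1, h2⟩ := ih (by omega)
      exact ⟨htrans _ _ _ h1 (hup b (by omega) hb), htrans _ _ _ (hdown b (by omega) hb) h2⟩
  rcases le_total a b with h | h
  · exact (key a b ha h hb').1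
  · exact (key b a hb h ha').2

/-- All slices of the same data are multiples of each other's images under equivariant maps. -/
lemma mapsToMultiple_sliceProd (D : PairData (Fin n₂)) (E : PairData (Fin n₃)) {w u w' u' : ℕ}
    (h1 : D.k + D.L.card ≤ w) (h2 : w + D.k ≤ n₂) (h3 : D.k + D.L.card ≤ u) (h4 : u + D.k ≤ n₂)
    (h1' : E.k + E.L.card ≤ w') (h2' : w' + E.k ≤ n₃) (h3' : E.k + E.L.card ≤ u')
    (h4' : u' + E.k ≤ n₃) :
    MapsToMultiple (G := codeStabilizer {(0 : Word n₂ n₃)}) (sliceProd 𝕜 D E w w')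
      (sliceProd 𝕜 D E u u') := by
  have hcast : ∀ {z : ℤ}, z ≠ 0 → (z : 𝕜) ≠ 0 := fun h => Int.cast_ne_zero.2 h
  refine MapsToMultiple.trans (h := sliceProd 𝕜 D E u w') ?_ ?_
  · refine rel_of_rel_succ
      (P := fun a b => MapsToMultiple (G := codeStabilizer {(0 : Word n₂ n₃)})
        (sliceProd 𝕜 D E a w') (sliceProd 𝕜 D E b w'))
      (fun a => .refl _) (fun a b c => .trans) (lo := D.k + D.L.card) (hi := n₂ - D.k)
      (fun a ha ha' => ?_) (fun a ha ha' => ?_) h1 (by omega) h3 (by omega)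
    · exact ⟨_, onFst_mem_equivariantEnd fun ρ f x => raise_comp_wordMap 𝕜 ρ (fun _ => rfl) f x,
        _, hcast (by omega), onFst_sliceProd (raise_slice 𝕜 D rfl a) E w'⟩
    · refine ⟨_, onFst_mem_equivariantEnd fun ρ f x => lower_comp_wordMap 𝕜 ρ (fun _ => rfl) f x,
        _, hcast (mul_ne_zero ?_ ?_), onFst_sliceProd (lower_slice 𝕜 D rfl (by simp) a) E w'⟩
      · decide
      · rw [Fintype.card_fin]
        omega
  · refine rel_of_rel_succ
      (P := fun a b => MapsToMultiple (G := codeStabilizer {(0 : Word n₂ n₃)})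
        (sliceProd 𝕜 D E u a) (sliceProd 𝕜 D E u b))
      (fun a => .refl _) (fun a b c => .trans) (lo := E.k + E.L.card) (hi := n₃ - E.k)
      (fun a ha ha' => ?_) (fun a ha ha' => ?_) h1' (by omega) h3' (by omega)
    · exact ⟨_, onSnd_mem_equivariantEnd fun ρ t f x =>
          raise_comp_wordMap 𝕜 ρ (fun j => letterPerm_zero (t j)) f x,
        _, hcast (by omega), onSnd_sliceProd (raise_slice 𝕜 E rfl a) D u⟩
    · refine ⟨_, onSnd_mem_equivariantEnd fun ρ t f x =>
          lower_comp_wordMap 𝕜 ρ (fun j => letterPerm_zero (t j)) f x,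
        _, hcast (mul_ne_zero ?_ ?_), onSnd_sliceProd (lower_slice 𝕜 E rfl (by decide) a) D u⟩
      · decide
      · rw [Fintype.card_fin]
        omega

end Shift

/-! ### Orthogonality of the orbits -/

section Orthogonality

variable {n₂ n₃ : ℕ}

lemma sum_slice_mul_slice_eq_zero {ι A : Type*} [Zero A] [DecidableEq A] [DecidableEq ι]
    [Fintype ι] [Fintype A] {ε : A → ℤ} {D E : PairData ι}
    (hflip : D.L = E.L ∨ ∃ s : Equiv.Perm A, s 0 = 0 ∧ (∀ c, s (s c) = c) ∧ ∀ c, ε (s c) = -ε c)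
    {w w' : ℕ} (h : D.k ≠ E.k ∨ D.L.card ≠ E.L.card ∨ w ≠ w') :
    ∑ x, D.slice ε w x * E.slice ε w' x = 0 := by
  by_cases hL : D.L = E.L
  · rcases h with h | h | h
    · rcases lt_or_gt_of_ne h with h | h
      · exact PairData.sum_slice_mul_slice_of_lt h hL w w'
      · simp only [mul_comm (D.slice ε w _)]
        exact PairData.sum_slice_mul_slice_of_lt h hL.symm w' w
    · exact absurd (congrArg Finset.card hL) h
    · refine Finset.sum_eq_zero fun x _ => ?_
      rw [PairData.slice, PairData.slice]
      split_ifs with h1 h2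
      · exact absurd (h1.symm.trans h2) h
      all_goals simp
  · obtain ⟨s, hs0, hs2, hs⟩ := hflip.resolve_left hL
    by_cases hsub : D.L ⊆ E.L
    · obtain ⟨i, hi, hi'⟩ := Finset.not_subset.1 fun h => hL (hsub.antisymm h)
      simp only [mul_comm (D.slice ε w _)]
      exact PairData.sum_slice_mul_slice_of_mem hs0 hs2 hs hi hi' w' w
    · obtain ⟨i, hi, hi'⟩ := Finset.not_subset.1 hsub
      exact PairData.sum_slice_mul_slice_of_mem hs0 hs2 hs hi hi' w w'

lemma signLetter_letterPerm : ∀ (s : Equiv.Perm (Fin 2)) (c : Fin 3),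
    signLetter (letterPerm s c) = Equiv.Perm.sign s * signLetter c := by
  decide

lemma exists_flip : ∃ s : Equiv.Perm (Fin 3), s 0 = 0 ∧ (∀ c, s (s c) = c) ∧
    ∀ c, signLetter (s c) = -signLetter c :=
  ⟨letterPerm (Equiv.swap 0 1), by decide, by decide, by decide⟩

variable {𝕜 : Type*} [RCLike 𝕜]

/-- The orbits of slices for different data or different weights are orthogonal. -/
lemma sum_star_sliceProd_mul_eq_zero {D D' : PairData (Fin n₂)} {E E' : PairData (Fin n₃)}
    {w w' u u' : ℕ} (hD : D.L = ∅) (hD' : D'.L = ∅)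
    (h : D.k ≠ D'.k ∨ w ≠ u ∨ E.k ≠ E'.k ∨ E.L.card ≠ E'.L.card ∨ w' ≠ u')
    (g : codeStabilizer {(0 : Word n₂ n₃)}) :
    ∑ v, star (sliceProd 𝕜 D E w w' (g • v)) * sliceProd 𝕜 D' E' u u' v = 0 := by
  obtain ⟨r, hr⟩ := D.exists_slice_wordMap (ε := (0 : Fin 2 → ℤ)) (stabilizerEquiv n₂ n₃ g).1⁻¹
    (t := fun _ => 1) (fun _ => rfl) (fun _ => ⟨1, fun _ => rfl⟩) w
  obtain ⟨r', hr'⟩ := E.exists_slice_wordMap (ε := signLetter)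
    (stabilizerEquiv n₂ n₃ g).2.right⁻¹
    (t := fun j => letterPerm ((stabilizerEquiv n₂ n₃ g).2.left j)) (fun _ => letterPerm_zero _)
    (fun _ => ⟨_, signLetter_letterPerm _⟩) w'
  have hterm : ∀ v : Word n₂ n₃, star (sliceProd 𝕜 D E w w' (g • v)) * sliceProd 𝕜 D' E' u u' v =
      ((r * r' * (((D.map (stabilizerEquiv n₂ n₃ g).1⁻¹).slice 0 w v.1 * D'.slice 0 u v.1) *
        ((E.map (stabilizerEquiv n₂ n₃ g).2.right⁻¹).slice signLetter w' v.2 *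
          E'.slice signLetter u' v.2)) : ℤ) : 𝕜) := by
    intro v
    rw [smul_eq_coordAct, sliceProd, sliceProd, coordAct_fst, coordAct_snd, hr, hr', star_intCast,
      ← Int.cast_mul]
    congr 1
    ring
  simp only [hterm]
  rw [← Int.cast_sum, ← Finset.mul_sum, Fintype.sum_prod_type]
  dsimp only
  rw [← Finset.sum_mul_sum, Int.cast_eq_zero]
  by_cases h1 : D.k ≠ D'.k ∨ w ≠ u
  · rw [sum_slice_mul_slice_eq_zero, zero_mul, mul_zero]
    · left
      rw [PairData.map_L, hD, hD', Finset.map_empty]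
    · exact h1.imp_right Or.inr
  · rw [sum_slice_mul_slice_eq_zero (Or.inr exists_flip), mul_zero, mul_zero]
    rw [PairData.map_L, Finset.card_map]
    change E.k ≠ E'.k ∨ _
    tauto

end Orthogonality

/-! ### Representative sets of tableau vectors -/

section Main

open YoungDiagram

variable {n₂ n₃ : ℕ}

namespace ShapeTriple

/-- A triple of shapes admitting tableaux is determined by the lengths of the second rows of `μ₁`
and `μ₂` and by the size of `μ₃`. -/
lemma eq_of_rowLen_eq {s s' : ShapeTriple n₂ n₃} (τ : s.W) (τ' : s'.W)
    (h1 : s.μ₁.rowLen 1 = s'.μ₁.rowLen 1) (h2 : s.μ₂.rowLen 1 = s'.μ₂.rowLen 1)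
    (h3 : s.μ₃.card = s'.μ₃.card) : s = s' := by
  have hrow : ∀ {μ : YoungDiagram} (τ : SSTableau μ 1), μ.rowLen 1 = 0 := fun {μ} τ => by
    by_contra h
    have := τ.2.row_eq_zero (μ.lowerCell ⟨0, Nat.pos_of_ne_zero h⟩)
    exact one_ne_zero this
  have e1 : s.μ₁ = s'.μ₁ := eq_of_le_one τ.1.2.le_one τ'.1.2.le_one (by rw [s.card₁, s'.card₁]) h1
  have e2 : s.μ₂ = s'.μ₂ := by
    refine eq_of_le_one τ.2.1.2.le_one τ'.2.1.2.le_one ?_ h2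
    have h4 := s.card₂₃
    have h5 := s'.card₂₃
    omega
  have e3 : s.μ₃ = s'.μ₃ :=
    eq_of_le_one (fun y => (τ.2.2.2.row_eq_zero y).trans_le zero_le_one)
      (fun y => (τ'.2.2.2.row_eq_zero y).trans_le zero_le_one) h3 (by rw [hrow τ.2.2, hrow τ'.2.2])
  cases s
  cases s'
  cases e1
  cases e2
  cases e3
  rfl

lemma W_ext {s : ShapeTriple n₂ n₃} {τ τ' : s.W} (h1 : numOnes τ.1.1 = numOnes τ'.1.1)
    (h2 : numOnes τ.2.1.1 = numOnes τ'.2.1.1) : τ = τ' :=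
  Prod.ext (Subtype.ext (τ.1.2.eq_of_numOnes_eq τ'.1.2 h1))
    (Prod.ext (Subtype.ext (τ.2.1.2.eq_of_numOnes_eq τ'.2.1.2 h2))
      (Subtype.ext (Subsingleton.elim _ _)))

lemma bounds {s : ShapeTriple n₂ n₃} (τ : s.W) :
    s.binPairs.k + s.binPairs.L.card ≤ numOnes τ.1.1 ∧ numOnes τ.1.1 + s.binPairs.k ≤ n₂ ∧
    s.ternPairs.k + s.ternPairs.L.card ≤ numOnes τ.2.1.1 + s.μ₃.card ∧
    numOnes τ.2.1.1 + s.μ₃.card + s.ternPairs.k ≤ n₃ := by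
  have h1 := τ.1.2.rowLen_le_numOnes
  have h2 := τ.1.2.numOnes_add_rowLen_le
  have h3 := τ.2.1.2.rowLen_le_numOnes
  have h4 := τ.2.1.2.numOnes_add_rowLen_le
  have h5 := s.card₁
  have h6 := s.card₂₃
  have h7 : s.binPairs.k = s.μ₁.rowLen 1 := rfl
  have h8 : s.ternPairs.k = s.μ₂.rowLen 1 := rfl
  have h9 : s.binPairs.L.card = 0 := rfl
  rw [card_ternPairs_L]
  omega

variable (𝕜 : Type*) [RCLike 𝕜]

lemma vec_eq_sliceProd {s : ShapeTriple n₂ n₃} (τ : s.W) :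
    s.vec 𝕜 τ = sliceProd 𝕜 s.binPairs s.ternPairs (numOnes τ.1.1)
      (numOnes τ.2.1.1 + s.μ₃.card) :=
  funext (s.vec_eq 𝕜 τ)

lemma exists_vec_ne_zero {s : ShapeTriple n₂ n₃} (τ : s.W) : ∃ v, s.vec 𝕜 τ v ≠ 0 := by
  obtain ⟨h1, h2, h3, h4⟩ := bounds τ
  obtain ⟨x, hx⟩ := s.binPairs.exists_slice_ne_zero (ε := (0 : Fin 2 → ℤ)) one_ne_zero
    (fun i hi => absurd hi (Finset.notMem_empty i)) h1 (by rwa [Fintype.card_fin])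
  obtain ⟨y, hy⟩ := s.ternPairs.exists_slice_ne_zero (ε := signLetter) (c := 1) (by decide)
    (fun i hi => by decide) h3 (by rwa [Fintype.card_fin])
  refine ⟨(x, y), ?_⟩
  rw [vec_eq]
  exact Int.cast_ne_zero.2 (mul_ne_zero hx hy)

variable {𝕜} in
/-- The vector `u_τ` is supported on words of weight `weight τ`. -/
lemma weight_eq_of_vec_ne_zero {s : ShapeTriple n₂ n₃} {τ : s.W} {v : Word n₂ n₃}
    (h : s.vec 𝕜 τ v ≠ 0) : s.weight τ = hammingNorm v.1 + hammingNorm v.2 := by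
  rw [vec_eq, Int.cast_ne_zero, PairData.slice, PairData.slice] at h
  rw [weight_eq]
  split_ifs at h with h1 h2
  · rw [h1, h2]
  all_goals simp at h

/-- For every pair of words there are tableaux of the same shapes whose contents are the weights of
the words, such that the shapes together with the weights determine the orbit of the pair. -/
lemma exists_tableaux (v w : Word n₂ n₃) : ∃ z : Σ s : ShapeTriple n₂ n₃, s.W × s.W,
    (z.1.μ₁.rowLen 1 = min (typeCount v.1 w.1 0) (typeCount v.1 w.1 3) ∧
      z.1.μ₂.rowLen 1 = min (typeCount v.2 w.2 0) (typeCount v.2 w.2 3) ∧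
      z.1.μ₃.card = typeCount v.2 w.2 4) ∧
    (numOnes z.2.1.1.1 = hammingNorm v.1 ∧
      numOnes z.2.1.2.1.1 + z.1.μ₃.card = hammingNorm v.2) ∧
    (numOnes z.2.2.1.1 = hammingNorm w.1 ∧
      numOnes z.2.2.2.1.1 + z.1.μ₃.card = hammingNorm w.2) := by
  have a1 := sum_typeCount v.1 w.1
  have a2 := hammingNorm_fst_eq v.1 w.1
  have a3 := hammingNorm_snd_eq v.1 w.1
  have b1 := sum_typeCount v.2 w.2
  have b2 := hammingNorm_fst_eq v.2 w.2
  have b3 := hammingNorm_snd_eq v.2 w.2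
  rw [Fintype.card_fin] at a1 b1
  obtain ⟨k, hk⟩ : ∃ k, k = min (typeCount v.1 w.1 0) (typeCount v.1 w.1 3) := ⟨_, rfl⟩
  obtain ⟨k', hk'⟩ : ∃ k, k = min (typeCount v.2 w.2 0) (typeCount v.2 w.2 3) := ⟨_, rfl⟩
  obtain ⟨l, hl⟩ : ∃ l, l = typeCount v.2 w.2 4 := ⟨_, rfl⟩
  have c1 : 2 * k ≤ n₂ := by omega
  have c2 : 2 * k' ≤ n₃ - l := by omega
  obtain ⟨τ₁, h1⟩ := exists_ssTableau_twoRow (w := hammingNorm v.1) c1 (by omega) (by omega)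
  obtain ⟨τ₂, h2⟩ := exists_ssTableau_twoRow (w := hammingNorm v.2 - l) c2 (by omega) (by omega)
  obtain ⟨σ₁, h3⟩ := exists_ssTableau_twoRow (w := hammingNorm w.1) c1 (by omega) (by omega)
  obtain ⟨σ₂, h4⟩ := exists_ssTableau_twoRow (w := hammingNorm w.2 - l) c2 (by omega) (by omega)
  have hrow : ∀ y : (twoRow l 0 (Nat.zero_le _)).cells, y.1.1 = 0 := by
    rintro ⟨⟨i, j⟩, hy⟩
    have h5 := mem_twoRow.1 ((YoungDiagram.mem_cells _).1 hy)
    simp only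
    omega
  let τ₃ : SSTableau (twoRow l 0 (Nat.zero_le _)) 1 := ⟨fun _ => 0, fun _ _ _ _ => le_rfl,
    fun y z _ h => by rw [hrow y, hrow z] at h; exact absurd h (lt_irrefl _)⟩
  refine ⟨⟨⟨twoRow n₂ k c1, twoRow (n₃ - l) k' c2, twoRow l 0 (Nat.zero_le _), card_twoRow, ?_⟩,
    (τ₁, τ₂, τ₃), (σ₁, σ₂, τ₃)⟩, ⟨?_, ?_, ?_⟩, ⟨h1, ?_⟩, ⟨h3, ?_⟩⟩
  · rw [card_twoRow, card_twoRow]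
    omega
  · simp only [rowLen_twoRow, hk]
  · simp only [rowLen_twoRow, hk']
  · simp only [card_twoRow, hl]
  · simp only [card_twoRow, h2]
    omega
  · simp only [card_twoRow, h4]
    omega

end ShapeTriple

open ShapeTriple

variable {𝕜 : Type*} [RCLike 𝕜]

/-- The vectors `u_τ` supported on the image of an equivariant injection of a finite set `Y` into
the words form a representative set for the action on `𝕜 ^ Y`, provided that all contents
realized in `Y` occur. -/
theorem isRepresentativeSet_vec {Y : Type*} [Fintype Y]
    [MulAction (codeStabilizer {(0 : Word n₂ n₃)}) Y] (φ : Y → Word n₂ n₃)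
    (hφ : Function.Injective φ)
    (hφG : ∀ (g : codeStabilizer {(0 : Word n₂ n₃)}) y, φ (g • y) = g • φ y)
    {I : Type*} {J : I → Type*} (hJ : ∀ i, Nonempty (J i)) (U : ∀ i, Matrix Y (J i) 𝕜)
    (sh : I → ShapeTriple n₂ n₃) (hsh : Function.Injective sh)
    (t : ∀ i, J i → (sh i).W) (ht : ∀ i, Function.Injective (t i))
    (hU : ∀ i j y, U i y j = (sh i).vec 𝕜 (t i j) (φ y))
    (hsupp : ∀ i j v, (sh i).vec 𝕜 (t i j) v ≠ 0 → v ∈ Set.range φ)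
    (hcont : ∀ y (s : ShapeTriple n₂ n₃) (τ : s.W),
      s.weight τ = hammingNorm (φ y).1 + hammingNorm (φ y).2 →
      ∃ i, ∃ h : sh i = s, ∃ j, h ▸ t i j = τ) :
    IsRepresentativeSet (permRep 𝕜 (codeStabilizer {(0 : Word n₂ n₃)}) Y) U := by
  classical
  have hext : ∀ i j, Function.ExtendByZero.linearMap 𝕜 φ ((U i).col j) =
      (sh i).vec 𝕜 (t i j) := by
    intro i j
    funext v
    change Function.extend φ ((U i).col j) 0 v = _
    by_cases hv : v ∈ Set.range φ
    · obtain ⟨y, rfl⟩ := hv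
      rw [hφ.extend_apply]
      exact hU i j y
    · rw [Function.extend_apply' _ _ _ hv, Pi.zero_apply]
      by_contra h
      exact hv (hsupp i j v (Ne.symm h))
  have hpair : ∀ p : Y × Y, ∃ z : Σ i, J i × J i, ∃ z' : Σ s : ShapeTriple n₂ n₃, s.W × s.W,
      z' = ⟨sh z.1, (t z.1 z.2.1, t z.1 z.2.2)⟩ ∧
      (z'.1.μ₁.rowLen 1 = min (typeCount (φ p.1).1 (φ p.2).1 0) (typeCount (φ p.1).1 (φ p.2).1 3) ∧
      z'.1.μ₂.rowLen 1 = min (typeCount (φ p.1).2 (φ p.2).2 0) (typeCount (φ p.1).2 (φ p.2).2 3) ∧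
      z'.1.μ₃.card = typeCount (φ p.1).2 (φ p.2).2 4) ∧
      (numOnes z'.2.1.1.1 = hammingNorm (φ p.1).1 ∧
        numOnes z'.2.1.2.1.1 + z'.1.μ₃.card = hammingNorm (φ p.1).2) ∧
      (numOnes z'.2.2.1.1 = hammingNorm (φ p.2).1 ∧
        numOnes z'.2.2.2.1.1 + z'.1.μ₃.card = hammingNorm (φ p.2).2) := by
    intro p
    obtain ⟨⟨s, τ, τ'⟩, hz⟩ := exists_tableaux (φ p.1) (φ p.2)
    obtain ⟨i, rfl, j, rfl⟩ := hcont p.1 s τ (by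
      rw [weight_eq, hz.2.1.1, hz.2.1.2])
    obtain ⟨i', hi, j', rfl⟩ := hcont p.2 (sh i) τ' (by
      rw [weight_eq, hz.2.2.1, hz.2.2.2])
    obtain rfl := hsh hi
    exact ⟨⟨i', j, j'⟩, _, rfl, hz⟩
  -- `κ` is a choice of tableaux for each pair; equal choices mean equal invariants of the pairs.
  choose κ κ' hκ' hκ1 hκ2 hκ3 using hpair
  refine isRepresentativeSet_of_separates_orbits U hJ ?_ ?_ ?_ κ ?_
  · intro i j h
    obtain ⟨v, hv⟩ := exists_vec_ne_zero 𝕜 (t i j)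
    rw [← hext, h, map_zero] at hv
    exact hv rfl
  · rintro ⟨i, j⟩ ⟨i', j'⟩ hne g
    -- Both vectors vanish outside the image of `Y`, so the sum may be taken over all words.
    have hsum : star (permRep 𝕜 (codeStabilizer {(0 : Word n₂ n₃)}) Y g ((U i).col j)) ⬝ᵥ
        (U i').col j' = ∑ v, star (sliceProd 𝕜 (sh i).binPairs (sh i).ternPairs
          (numOnes (t i j).1.1) (numOnes (t i j).2.1.1 + (sh i).μ₃.card) (g⁻¹ • v)) *
          sliceProd 𝕜 (sh i').binPairs (sh i').ternPairs (numOnes (t i' j').1.1)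
            (numOnes (t i' j').2.1.1 + (sh i').μ₃.card) v := by
      rw [← vec_eq_sliceProd, ← vec_eq_sliceProd]
      refine Fintype.sum_of_injective φ hφ _ _ (fun v hv => ?_) fun y => ?_
      · by_contra h
        exact hv (hsupp i' j' v (right_ne_zero_of_mul h))
      · rw [← hφG, ← hU]
        exact congrArg _ (hU i' j' y)
    rw [hsum]
    refine sum_star_sliceProd_mul_eq_zero rfl rfl ?_ _
    rw [card_ternPairs_L, card_ternPairs_L]
    by_contra! hcon
    obtain ⟨e1, e2, e3, e4, e5⟩ := hcon
    obtain rfl := hsh (eq_of_rowLen_eq (t i j) (t i' j') e1 e3 e4)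
    exact hne (congrArg _ (ht i (W_ext e2 (by omega))))
  · intro i j j'
    obtain ⟨h1, h2, h3, h4⟩ := bounds (t i j)
    obtain ⟨h1', h2', h3', h4'⟩ := bounds (t i j')
    obtain ⟨Φ, hΦ, c, hc, h⟩ := mapsToMultiple_sliceProd (𝕜 := 𝕜) (sh i).binPairs (sh i).ternPairs
      h1 h2 h1' h2' h3 h4 h3' h4'
    rw [← vec_eq_sliceProd, ← vec_eq_sliceProd] at h
    refine ⟨LinearMap.funLeft 𝕜 𝕜 φ ∘ₗ Φ ∘ₗ Function.ExtendByZero.linearMap 𝕜 φ, fun g f => ?_,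
      c, hc, ?_⟩
    · have h5 : Function.ExtendByZero.linearMap 𝕜 φ (permRep 𝕜 _ Y g f) =
          permRep 𝕜 _ (Word n₂ n₃) g (Function.ExtendByZero.linearMap 𝕜 φ f) := by
        funext v
        rw [permRep_apply]
        change Function.extend φ _ 0 v = Function.extend φ f 0 (g⁻¹ • v)
        by_cases hv : v ∈ Set.range φ
        · obtain ⟨y, rfl⟩ := hv
          rw [hφ.extend_apply, ← hφG, hφ.extend_apply, permRep_apply]
        · rw [Function.extend_apply' _ _ _ hv, Function.extend_apply']
          · rfl
          · rintro ⟨y, hy⟩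
            exact hv ⟨g • y, by rw [hφG, hy, smul_inv_smul]⟩
      simp only [LinearMap.comp_apply, h5, hΦ g]
      funext y
      rw [permRep_apply, LinearMap.funLeft_apply, LinearMap.funLeft_apply, permRep_apply, hφG]
    · simp only [LinearMap.comp_apply, hext, h, map_smul]
      congr 1
      funext y
      exact (hU i j' y).symm
  · intro p q hpq
    have hz : κ' p = κ' q := by rw [hκ', hκ', hpq]
    have h1 := hκ1 p
    have h2 := hκ2 p
    have h3 := hκ3 p
    rw [hz] at h1 h2 h3
    obtain ⟨g, hg1, hg2⟩ := exists_smul_pair_eq (h2.1.symm.trans (hκ2 q).1)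
      (h3.1.symm.trans (hκ3 q).1) (h2.2.symm.trans (hκ2 q).2) (h3.2.symm.trans (hκ3 q).2)
      (h1.1.symm.trans (hκ1 q).1) (h1.2.1.symm.trans (hκ1 q).2.1)
      (h1.2.2.symm.trans (hκ1 q).2.2)
    refine ⟨g, Prod.ext (hφ ?_) (hφ ?_)⟩
    · rw [Prod.smul_fst, hφG, hg1]
    · rw [Prod.smul_snd, hφG, hg2]

end Main

/-! ### Codes containing the zero word -/

section CodesOfSizeTwo

variable {n₂ n₃ : ℕ}

lemma insert_zero_injective {v w : Word n₂ n₃}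
    (h : ({0, v} : Finset (Word n₂ n₃)) = {0, w}) : v = w := by
  have h1 : v ∈ ({0, w} : Finset (Word n₂ n₃)) := h ▸ by simp
  have h2 : w ∈ ({0, v} : Finset (Word n₂ n₃)) := h ▸ by simp
  simp only [Finset.mem_insert, Finset.mem_singleton] at h1 h2
  rcases h1 with h1 | h1
  · rcases h2 with h2 | h2
    · rw [h1, h2]
    · exact h2.symm
  · exact h1

lemma insert_zero_mem_admissibleCodes {d : ℕ} {v : Word n₂ n₃} :
    ({0, v} : Finset (Word n₂ n₃)) ∈ admissibleCodes 3 d {(0 : Word n₂ n₃)} ↔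
      (hammingNorm v.1 + hammingNorm v.2 = 0 ∨ d ≤ hammingNorm v.1 + hammingNorm v.2) := by
  have hd : wordDist 0 v = hammingNorm v.1 + hammingNorm v.2 := by
    rw [wordDist]
    exact congrArg₂ (· + ·) (congrFun hammingDist_zero_left _) (congrFun hammingDist_zero_left _)
  have hd' : wordDist v 0 = hammingNorm v.1 + hammingNorm v.2 := by
    rw [wordDist]
    exact congrArg₂ (· + ·) (hammingDist_zero_right _) (hammingDist_zero_right _)
  have h0 : hammingNorm v.1 + hammingNorm v.2 = 0 ↔ v = 0 := by
    rw [Nat.add_eq_zero_iff, hammingNorm_eq_zero, hammingNorm_eq_zero, Prod.ext_iff]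
    rfl
  rw [h0]
  constructor
  · rintro ⟨-, h⟩
    by_cases hv : v = 0
    · exact Or.inl hv
    · right
      rw [← hd]
      exact h 0 (by simp) v (by simp) (Ne.symm hv)
  · intro h
    refine ⟨⟨?_, by simp, ?_⟩, ?_⟩
    · have := Finset.card_le_two (a := (0 : Word n₂ n₃)) (b := v)
      omega
    · have h1 : (({0, v} : Finset (Word n₂ n₃)) \ {0}).card ≤ 1 := by
        refine (Finset.card_le_card (t := {v}) fun x hx => ?_).trans (Finset.card_singleton v).le
        simp only [Finset.mem_sdiff, Finset.mem_insert, Finset.mem_singleton] at hx ⊢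
        tauto
      rw [Finset.card_singleton]
      omega
    · intro x hx y hy hxy
      simp only [Finset.mem_insert, Finset.mem_singleton] at hx hy
      rcases hx with rfl | rfl <;> rcases hy with rfl | rfl
      · exact absurd rfl hxy
      · rw [hd]
        exact h.resolve_left (Ne.symm hxy)
      · rw [hd']
        exact h.resolve_left hxy
      · exact absurd rfl hxy

lemma exists_insert_zero_eq {d : ℕ} (C : admissibleCodes 3 d {(0 : Word n₂ n₃)}) :
    ∃ v : Word n₂ n₃, {0, v} = C.1 := by
  obtain ⟨C, ⟨-, h2, h3⟩, -⟩ := C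
  rw [Finset.singleton_subset_iff] at h2
  rw [Finset.card_singleton] at h3
  rcases Finset.eq_empty_or_nonempty (C \ {0}) with h | ⟨v, hv⟩
  · refine ⟨0, ?_⟩
    rw [Finset.sdiff_eq_empty_iff_subset] at h
    simpa using (h.antisymm (Finset.singleton_subset_iff.2 h2)).symm
  · refine ⟨v, ?_⟩
    have h4 : C \ {0} = {v} := Finset.eq_singleton_iff_unique_mem.2
      ⟨hv, fun w hw => Finset.card_le_one.1 (by omega) w hw v hv⟩
    change {0, v} = C
    rw [← Finset.insert_sdiff_self_of_mem h2, h4]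

end CodesOfSizeTwo

theorem mainTheorem2 (𝕜 : Type*) [RCLike 𝕜] (n₂ n₃ d : ℕ) :
    (∃ e : codeStabilizer {(0 : Word n₂ n₃)} ≃*
        Equiv.Perm (Fin n₂) ×
          ((Fin n₃ → Equiv.Perm (Fin 2)) ⋊[mulAutArrow] Equiv.Perm (Fin n₃)),
      ∀ (g : codeStabilizer {(0 : Word n₂ n₃)}) (v : Word n₂ n₃),
        g • v = (fun i => v.1 ((e g).1⁻¹ i),
          fun j => letterMap ((e g).2.left j) (v.2 ((e g).2.right⁻¹ j)))) ∧
    IsRepresentativeSet (permRep 𝕜 (codeStabilizer {(0 : Word n₂ n₃)}) (Word n₂ n₃))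
      (fun s : {s : ShapeTriple n₂ n₃ // Nonempty s.W} => wordMatrix 𝕜 s.1) ∧
    IsRepresentativeSet
      (permRep 𝕜 (codeStabilizer {(0 : Word n₂ n₃)}) (admissibleCodes 3 d {(0 : Word n₂ n₃)}))
      (fun s : {s : ShapeTriple n₂ n₃ // Nonempty (s.W' d)} => codeMatrix 𝕜 d s.1) := by
  classical
  refine ⟨⟨stabilizerEquiv n₂ n₃, smul_eq_coordAct⟩, ?_, ?_⟩
  · refine isRepresentativeSet_vec id Function.injective_id (fun _ _ => rfl) (fun s => s.2) _
      Subtype.val Subtype.val_injective (fun _ τ => τ) (fun _ => Function.injective_id)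
      (fun _ _ _ => rfl) (fun _ _ v _ => ⟨v, rfl⟩) fun _ s τ _ => ?_
    exact ⟨⟨s, ⟨τ⟩⟩, rfl, τ, rfl⟩
  · choose φ hφ using fun C => exists_insert_zero_eq (n₂ := n₂) (n₃ := n₃) (d := d) C
    have hmem : ∀ v : Word n₂ n₃,
        (hammingNorm v.1 + hammingNorm v.2 = 0 ∨ d ≤ hammingNorm v.1 + hammingNorm v.2) ↔
          v ∈ Set.range φ := by
      intro v
      rw [← insert_zero_mem_admissibleCodes]
      constructor
      · intro h
        exact ⟨⟨_, h⟩, insert_zero_injective (hφ ⟨_, h⟩)⟩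
      · rintro ⟨C, rfl⟩
        rw [hφ]
        exact C.2
    refine isRepresentativeSet_vec φ (fun C C' h => Subtype.ext (by rw [← hφ, ← hφ, h]))
      (fun g C => insert_zero_injective ?_) (fun s => s.2) _ Subtype.val Subtype.val_injective
      (fun _ τ => τ.1) (fun _ => Subtype.val_injective) (fun s τ C => ?_) (fun s τ v hv => ?_)
      fun C s τ hτ => ?_
    · have hg : g • (0 : Word n₂ n₃) = 0 := by
        rw [smul_eq_coordAct, coordAct_zero]
      rw [hφ]
      change g • C.1 = _
      rw [← hφ, Finset.smul_finset_insert, Finset.smul_finset_singleton, hg]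
    · change ∑ v : Word n₂ n₃ with ({0, v} : Finset (Word n₂ n₃)) = C.1, s.1.vec 𝕜 τ.1 v = _
      have h : (Finset.univ.filter fun v : Word n₂ n₃ => ({0, v} : Finset (Word n₂ n₃)) = C.1) =
          {φ C} := by
        ext v
        rw [Finset.mem_filter, Finset.mem_singleton, ← hφ C]
        exact ⟨fun h => insert_zero_injective h.2, fun h => ⟨Finset.mem_univ _, by rw [h]⟩⟩
      rw [h, Finset.sum_singleton]
    · rw [← hmem]
      have h := τ.2
      rw [ShapeTriple.weight_eq_of_vec_ne_zero hv] at h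
      exact_mod_cast h
    · have h := (hmem (φ C)).2 ⟨C, rfl⟩
      have h' : s.weight τ = 0 ∨ (d : ℤ) ≤ s.weight τ := by
        rw [hτ]
        exact_mod_cast h
      exact ⟨⟨s, ⟨⟨τ, h'⟩⟩⟩, rfl, ⟨τ, h'⟩, rfl⟩
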